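/- Let $k\in\mathbb N$, $\mathcal X=\{1,\dots,k\}$, and let $(p_{ij})_{i,j\in\mathcal X}$ be an irreducible stochastic matrix with $p_{ii}=0$ for all $i$. For each $i\in\mathcal X$ let $F(\cdot\mid i)$ be a distribution function with $F(y\mid i)=0$ for $y\le 0$ that has, on $[0,\infty)$, a bounded and continuously differentiable derivative $f(\cdot\mid i)$ (derivatives at $0$ being one-sided) with $f(y\mid i)\neq 0$ for $y>0$. For $i\ne j$ and $y\ge 0$ put $$\lambda_{ij}(y)=p_{ij}\,\frac{f(y\mid i)}{1-F(y\mid i)},$$ and let $\Lambda_{ij}(y)$, $i\neq j$, be consecutive (in the lexicographic order of the pairs $(i,j)$) left closed, right open intervals of $\mathbb R$ of lengths $\lambda_{ij}(y)$, the first of which begins at a fixed point $c\in\mathbb R$. Identify $i\in\mathcal X$ with the unit vector $e_i\in\mathbb R^k$, and put $$h(i,y,z)=\begin{cases} j-i & \text{if } z\in\Lambda_{ij}(y) \text{ for some } j\neq i,\\ 0&\text{otherwise,}\end{cases}\qquad g(i,y,z)=\begin{cases} y & \text{if } z\in\Lambda_{ij}(y)\text{ for some } j\ne i,\\ 0&\text{otherwise.}\end{cases}$$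 On a probability space $(\Omega,\mathcal F,P)$ let $\wp(dt,dz)$ be a Poisson random measure on $(0,\infty)\times\mathbb R$ with intensity $dt\,dz$, and let $X=(X_t)_{t\ge0}$, with values in $\mathcal X$, and $Y=(Y_t)_{t\ge 0}$, real-valued, be processes such that $X_0$ is independent of $\wp$ and, almost surely for all $t\ge0$, $$X_t = X_0+\int_{(0,t]}\int_{\mathbb R} h(X_{u-},Y_{u-},z)\,\wp(du,dz),\qquad Y_t=t-\int_{(0,t]}\int_{\mathbb R} g(X_{u-},Y_{u-},z)\,\wp(du,dz),$$ where the left limits are assumed to exist and the integrals to converge absolutely. Then $X$ is a semi-Markov process with transition matrix $(p_{ij})$ and conditional holding time distributions $F(\cdot\mid i)$. That is, there are random times $0=T_0<T_1<T_2<\cdots$ (almost surely) with $T_n\to\infty$ such that, almost surely, $X$ is constant on each $[T_n,T_{n+1})$ and $X_{T_{n+1}}\ne X_{T_n}$, and for all $n\ge0$, $j\in\mathcal X$ and $y\in\mathbb R$, $$P\big(X_{T_{n+1}}=j,\ T_{n+1}-T_n\le y \,\big|\, X_{T_0},T_0,\dots,X_{T_n},T_n\big)=p_{X_{T_n}j}\,F(y\mid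 X_{T_n})\quad\text{almost surely.}$$ -/

import Mathlib

open MeasureTheory ProbabilityTheory Filter Set
open scoped Topology ENNReal

namespace SemiMarkov

noncomputable section

/-- A Poisson random measure `N` on `E` with intensity measure `ν`, on the probability space
`(Ω, μ)`: a random measure with values in `{0, 1, 2, …, ∞}` such that `N B` is Poisson distributed
with mean `ν B` (and almost surely infinite if `ν B = ∞`), and such that its values on pairwise
disjoint sets are independent. -/
structure IsPoissonRandomMeasure {Ω E : Type*} [MeasurableSpace Ω] [MeasurableSpace E]
    (μ : Measure Ω) (N : Ω → Measure E) (ν : Measure E) : Prop where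
  measurable : Measurable N
  integerValued : ∀ᵐ ω ∂μ, ∀ B : Set E, MeasurableSet B → ∃ n : ℕ∞, N ω B = (n : ℝ≥0∞)
  law : ∀ B : Set E, MeasurableSet B → ν B ≠ ∞ → ∀ n : ℕ,
    μ {ω | N ω B = (n : ℝ≥0∞)} = poissonMeasure (ν B).toNNReal {n}
  infinite : ∀ B : Set E, MeasurableSet B → ν B = ∞ → ∀ᵐ ω ∂μ, N ω B = ∞
  indep : ∀ (m : ℕ) (B : Fin m → Set E), (∀ l, MeasurableSet (B l)) →
    Pairwise (Function.onFun Disjoint B) → iIndepFun (fun l ω => N ω (B l)) μ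

/-- Lebesgue measure `dt dz` on `(0, ∞) × ℝ`, as a measure on `ℝ × ℝ`. -/
def intensity : Measure (ℝ × ℝ) := volume.restrict (Ioi 0 ×ˢ univ)

/-- `G` is the distribution function of a (positive, finite) holding time; on `[0, ∞)` it has the
bounded and continuously differentiable derivative `g`, and `g` has no zero on `(0, ∞)`.
All derivatives on `[0, ∞)` are one-sided at `0`. -/
structure IsHoldingTimeDistribution (G g : ℝ → ℝ) : Prop where
  monotone : Monotone G
  eq_zero : ∀ y ≤ 0, G y = 0
  tendsto_one : Tendsto G atTop (𝓝 1)
  hasDeriv : ∀ y, 0 ≤ y → HasDerivWithinAt G (g y) (Ici 0) y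
  bounded : ∃ C : ℝ, ∀ y, 0 ≤ y → |g y| ≤ C
  contDiff : ContDiffOn ℝ 1 g (Ici 0)
  ne_zero : ∀ y, 0 < y → g y ≠ 0

section Coefficients

variable {k : ℕ} (p : Matrix (Fin k) (Fin k) ℝ) (F f : Fin k → ℝ → ℝ) (c : ℝ)

/-- The instantaneous rate `λ_ij(y)` of a transition from `i` to `j ≠ i` at age `y`
(only used for `i ≠ j` and `y ≥ 0`). -/
def rate (i j : Fin k) (y : ℝ) : ℝ := p i j * (f i y / (1 - F i y))

/-- The left end point of `Λ_ij(y)`: the origin `c`, plus the lengths of all the intervals whose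
index pair precedes `(i, j)` in the lexicographic order. -/
def leftEnd (i j : Fin k) (y : ℝ) : ℝ :=
  c + ∑ q : Fin k × Fin k with q.1 ≠ q.2 ∧ toLex q < toLex (i, j), rate p F f q.1 q.2 y

/-- The consecutive left closed, right open intervals `Λ_ij(y)` (`i ≠ j`) of length `λ_ij(y)`; the
first of them begins at `c`. -/
def Lam (i j : Fin k) (y : ℝ) : Set ℝ :=
  Ico (leftEnd p F f c i j y) (leftEnd p F f c i j y + rate p F f i j y)

/-- The state `i`, regarded as the unit vector `e_i` of `ℝ^k`. -/
def e (i : Fin k) : Fin k → ℝ := Pi.single i 1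

open Classical in
/-- `h(i, y, z) = e_j - e_i` if `z ∈ Λ_ij(y)` for some `j ≠ i`, and `0` otherwise
(the intervals are disjoint, so at most one summand is non-zero). -/
def h (i : Fin k) (y z : ℝ) : Fin k → ℝ :=
  ∑ j : Fin k, if j ≠ i ∧ z ∈ Lam p F f c i j y then e j - e i else 0

open Classical in
/-- `g(i, y, z) = y` if `z ∈ Λ_ij(y)` for some `j ≠ i`, and `0` otherwise. -/
def g (i : Fin k) (y z : ℝ) : ℝ :=
  if ∃ j, j ≠ i ∧ z ∈ Lam p F f c i j y then y else 0

/-- `(X, Y)` solves, almost surely for all `t ≥ 0`, the stochastic integral equations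
`X_t = X_0 + ∫_{(0,t] × ℝ} h(X_{u-}, Y_{u-}, z) N(du, dz)`,
`Y_t = t - ∫_{(0,t] × ℝ} g(X_{u-}, Y_{u-}, z) N(du, dz)`.
The first two clauses say that the left limits and the integrals in the equations make sense.
The values of `X` and `Y` at negative times play no role. -/
structure IsSolution {Ω : Type*} [MeasurableSpace Ω] (μ : Measure Ω) (N : Ω → Measure (ℝ × ℝ))
    (X : ℝ → Ω → Fin k) (Y : ℝ → Ω → ℝ) : Prop where
  leftLimits : ∀ᵐ ω ∂μ, ∀ u, 0 < u →
    (∃ i, Tendsto (fun s => X s ω) (𝓝[<] u) (𝓝 i)) ∧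
    (∃ y, Tendsto (fun s => Y s ω) (𝓝[<] u) (𝓝 y))
  integrable : ∀ᵐ ω ∂μ, ∀ t, 0 ≤ t →
    IntegrableOn (fun q : ℝ × ℝ => h p F f c (Function.leftLim (fun s => X s ω) q.1)
      (Function.leftLim (fun s => Y s ω) q.1) q.2) (Ioc 0 t ×ˢ univ) (N ω) ∧
    IntegrableOn (fun q : ℝ × ℝ => g p F f c (Function.leftLim (fun s => X s ω) q.1)
      (Function.leftLim (fun s => Y s ω) q.1) q.2) (Ioc 0 t ×ˢ univ) (N ω)
  eq_X : ∀ᵐ ω ∂μ, ∀ t, 0 ≤ t →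
    e (X t ω) = e (X 0 ω) + ∫ q in Ioc 0 t ×ˢ univ,
      h p F f c (Function.leftLim (fun s => X s ω) q.1)
        (Function.leftLim (fun s => Y s ω) q.1) q.2 ∂(N ω)
  eq_Y : ∀ᵐ ω ∂μ, ∀ t, 0 ≤ t →
    Y t ω = t - ∫ q in Ioc 0 t ×ˢ univ,
      g p F f c (Function.leftLim (fun s => X s ω) q.1)
        (Function.leftLim (fun s => Y s ω) q.1) q.2 ∂(N ω)

end Coefficients

/-- The σ-algebra generated by `(J_0, T_0), …, (J_n, T_n)`. -/
@[reducible] def history {Ω : Type*} {k : ℕ} (J : ℕ → Ω → Fin k) (T : ℕ → Ω → ℝ) (n : ℕ) :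
    MeasurableSpace Ω :=
  MeasurableSpace.comap (fun ω (m : Fin (n + 1)) => (J m ω, T m ω)) inferInstance

/-- `(J, T)` is a Markov renewal process with transition matrix `p` and conditional holding time
distribution functions `F i`: `0 = T_0 < T_1 < ⋯` and
`P(J_{n+1} = j, T_{n+1} - T_n ≤ y | J_0, T_0, …, J_n, T_n) = p_{J_n j} F(y | J_n)` almost surely. -/
structure IsMarkovRenewal {Ω : Type*} [MeasurableSpace Ω] {k : ℕ} (μ : Measure Ω)
    (J : ℕ → Ω → Fin k) (T : ℕ → Ω → ℝ) (p : Matrix (Fin k) (Fin k) ℝ) (F : Fin k → ℝ → ℝ) :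
    Prop where
  measurable_J : ∀ n, Measurable (J n)
  measurable_T : ∀ n, Measurable (T n)
  zero : ∀ᵐ ω ∂μ, T 0 ω = 0
  strictMono : ∀ᵐ ω ∂μ, StrictMono (fun n => T n ω)
  renewal : ∀ (n : ℕ) (j : Fin k) (y : ℝ),
    μ⟦{ω | J (n + 1) ω = j ∧ T (n + 1) ω - T n ω ≤ y} | history J T n⟧
      =ᵐ[μ] fun ω => p (J n ω) j * F (J n ω) y

/-- `X = (X_t)_{t ≥ 0}` is a semi-Markov process with transition matrix `p` and conditional holding
time distribution functions `F i`: almost surely it is a step process whose consecutive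
transition times `0 = T_0 < T_1 < T_2 < ⋯` increase to `∞`, it has the constant value `J_n = X_{T_n}`
on `[T_n, T_{n+1})` and changes its value at each `T_{n+1}`, and `(J_n, T_n)` is a Markov renewal
process with the data `p` and `F`. (The `T_n` and `J_n` are almost surely determined by `X`.) -/
def IsSemiMarkov {Ω : Type*} [MeasurableSpace Ω] {k : ℕ} (μ : Measure Ω)
    (X : ℝ → Ω → Fin k) (p : Matrix (Fin k) (Fin k) ℝ) (F : Fin k → ℝ → ℝ) : Prop :=
  ∃ (J : ℕ → Ω → Fin k) (T : ℕ → Ω → ℝ),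
    IsMarkovRenewal μ J T p F ∧
    ∀ᵐ ω ∂μ, Tendsto (fun n => T n ω) atTop atTop ∧
      (∀ n, J (n + 1) ω ≠ J n ω) ∧
      ∀ n t, T n ω ≤ t → t < T (n + 1) ω → X t ω = J n ω

end

end SemiMarkov

/-! Suppose that state `i` is entered at time `t`, and describe the later points of the driving
measure by their age (time minus `t`) and mark. As long as no point falls into one of the sets
`region i j`, whose section at age `s` is `Λ_ij(s)`, the integral equations keep `X = i` and let `Y`
equal the age. The first point in one of these sets moves `X` to the index `j` of the set hit and
resets `Y` to `0`. This is `PathSolution.step`; it shows that the transition times and states of any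
solution are the measurable functional `traj` of `X 0` and the point configuration. Transition times
cannot accumulate, because `X` has left limits in a finite set.

The probability enters through void probabilities only. The `n`-th transition time depends on points
up to that time, so the points after it are again Poisson and independent of the past:
`measure_hist_avoids`. Since the rows of `p` sum to one, the regions leaving `i` have total area
`H(y) = -log (1 - F i y)` up to age `y` (`volume_iUnion_region`), so survival beyond age `y` has
conditional probability at most `exp (-H(y)) = 1 - F i y`; letting `y` tend to infinity, all
transition times are finite.

A transition to `j` at an age in `(a, b]` forces all regions to be void up to age `a` and `region i
j` to have a point in `(a, b]`, which has conditional probability `exp (-H(a)) (1 - exp (-p i j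
(H(b) - H(a))))`. Comparing derivatives (`le_of_increment_le`) gives the upper bound `p i j * F i y`
for the probability of a transition to `j` by age `y`. These upper bounds and the survival bound add
up to the full mass, so each of them is an equality: `measureReal_transition`. No lower bound has to
be proved separately. -/

namespace SemiMarkov

/-! ### Holding time distributions and their hazard. -/

namespace IsHoldingTimeDistribution

variable {G g : ℝ → ℝ}

lemma le_one (hG : IsHoldingTimeDistribution G g) (y : ℝ) : G y ≤ 1 :=
  hG.monotone.ge_of_tendsto hG.tendsto_one y

lemma density_nonneg (hG : IsHoldingTimeDistribution G g) {y : ℝ} (hy : 0 ≤ y) : 0 ≤ g y := by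
  have h1 := ((hG.hasDeriv y hy).mono (Ici_subset_Ici.2 hy)).Ioi_of_Ici
  rw [hasDerivWithinAt_iff_tendsto_slope' (by simp)] at h1
  refine ge_of_tendsto h1 ?_
  filter_upwards [self_mem_nhdsWithin] with z hz
  rw [slope_def_field]
  exact div_nonneg (sub_nonneg.2 (hG.monotone (le_of_lt hz))) (sub_nonneg.2 (le_of_lt hz))

/-- Once `G` reached `1` it would stay constant and its derivative would vanish, against `ne_zero`.
Hence the hazard rate and its integral are finite at every age. -/
lemma lt_one (hG : IsHoldingTimeDistribution G g) (y : ℝ) : G y < 1 := by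
  refine lt_of_le_of_ne (hG.le_one y) fun hy => ?_
  have hc : ∀ z, y ≤ z → G z = 1 := fun z hz =>
    le_antisymm (hG.le_one z) (hy ▸ hG.monotone hz)
  have h0 : 0 < y := by
    by_contra h
    rw [hG.eq_zero y (not_lt.1 h)] at hy
    exact zero_ne_one hy
  have h1 : HasDerivAt G (g (y + 1)) (y + 1) :=
    (hG.hasDeriv (y + 1) (by linarith)).hasDerivAt (Ici_mem_nhds (by linarith))
  have h2 : HasDerivAt G 0 (y + 1) := by
    refine (hasDerivAt_const (y + 1) (1 : ℝ)).congr_of_eventuallyEq ?_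
    filter_upwards [Ici_mem_nhds (show y < y + 1 by linarith)] with z hz
    exact hc z hz
  exact hG.ne_zero (y + 1) (by linarith) (h1.unique h2)

lemma continuous (hG : IsHoldingTimeDistribution G g) : Continuous G := by
  have h0 : G = fun y => G (max y 0) := by
    ext y
    rcases le_total y 0 with h | h
    · rw [max_eq_right h, hG.eq_zero y h, hG.eq_zero 0 le_rfl]
    · rw [max_eq_left h]
  have h1 : ContinuousOn G (Ici 0) := fun y hy => (hG.hasDeriv y hy).continuousWithinAt
  rw [h0]
  exact h1.comp_continuous (by fun_prop) fun y => mem_Ici.2 (le_max_right _ _)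

lemma density_continuousOn (hG : IsHoldingTimeDistribution G g) : ContinuousOn g (Ici 0) :=
  hG.contDiff.continuousOn

/-- The hazard rate, at ages `≥ 0`. -/
lemma hazard_continuousOn (hG : IsHoldingTimeDistribution G g) :
    ContinuousOn (fun y => g y / (1 - G y)) (Ici 0) :=
  hG.density_continuousOn.div (by have := hG.continuous; fun_prop)
    fun y _ => (sub_pos.2 (hG.lt_one y)).ne'

lemma hazard_nonneg (hG : IsHoldingTimeDistribution G g) {y : ℝ} (hy : 0 ≤ y) :
    0 ≤ g y / (1 - G y) :=
  div_nonneg (hG.density_nonneg hy) (sub_pos.2 (hG.lt_one y)).le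

end IsHoldingTimeDistribution

/-- The integrated hazard `-log (1 - G)`. -/
noncomputable def cumHazard (G : ℝ → ℝ) (y : ℝ) : ℝ := -Real.log (1 - G y)

namespace IsHoldingTimeDistribution

variable {G g : ℝ → ℝ}

lemma exp_neg_cumHazard (hG : IsHoldingTimeDistribution G g) (y : ℝ) :
    Real.exp (-cumHazard G y) = 1 - G y := by
  rw [cumHazard, neg_neg, Real.exp_log (sub_pos.2 (hG.lt_one y))]

lemma cumHazard_zero (hG : IsHoldingTimeDistribution G g) : cumHazard G 0 = 0 := by
  simp [cumHazard, hG.eq_zero 0 le_rfl]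

lemma cumHazard_continuous (hG : IsHoldingTimeDistribution G g) : Continuous (cumHazard G) :=
  ((continuous_const.sub hG.continuous).log fun y => (sub_pos.2 (hG.lt_one y)).ne').neg

lemma cumHazard_monotone (hG : IsHoldingTimeDistribution G g) : Monotone (cumHazard G) := by
  intro a b hab
  exact neg_le_neg (Real.log_le_log (sub_pos.2 (hG.lt_one b))
    (sub_le_sub_left (hG.monotone hab) 1))

lemma hasDerivWithinAt_cumHazard (hG : IsHoldingTimeDistribution G g) {y : ℝ} (hy : 0 ≤ y) :
    HasDerivWithinAt (cumHazard G) (g y / (1 - G y)) (Ici 0) y := by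
  have h1 := (((hasDerivWithinAt_const y (Ici 0) (1 : ℝ)).sub (hG.hasDeriv y hy)).log
    (sub_pos.2 (hG.lt_one y)).ne').neg
  have h2 : g y / (1 - G y) = -((0 - g y) / (1 - G y)) := by ring
  rw [h2]
  exact h1

lemma integrableOn_hazard (hG : IsHoldingTimeDistribution G g) {a b : ℝ} (ha : 0 ≤ a) :
    IntegrableOn (fun y => g y / (1 - G y)) (Ioc a b) :=
  ((hG.hazard_continuousOn.mono
    (Icc_subset_Ici_self.trans (Ici_subset_Ici.2 ha))).integrableOn_Icc).mono_set Ioc_subset_Icc_self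

lemma integral_hazard (hG : IsHoldingTimeDistribution G g) {a b : ℝ} (ha : 0 ≤ a) (hab : a ≤ b) :
    ∫ y in Ioc a b, g y / (1 - G y) = cumHazard G b - cumHazard G a := by
  rw [← intervalIntegral.integral_of_le hab]
  refine intervalIntegral.integral_eq_sub_of_hasDerivAt_of_le hab
    hG.cumHazard_continuous.continuousOn (fun y hy => ?_) ?_
  · have hy0 : 0 < y := ha.trans_lt hy.1
    exact (hG.hasDerivWithinAt_cumHazard hy0.le).hasDerivAt (Ici_mem_nhds hy0)
  · rw [intervalIntegrable_iff_integrableOn_Ioc_of_le hab]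
    exact hG.integrableOn_hazard ha

end IsHoldingTimeDistribution

/-! ### Transition regions in age-mark coordinates and their areas. -/

/-- The points `(s, z)` such that a point of the driving measure with mark `z` at age `s` leads
from `i` to `j`. -/
def region {k : ℕ} (p : Matrix (Fin k) (Fin k) ℝ) (F f : Fin k → ℝ → ℝ) (c : ℝ) (i j : Fin k) :
    Set (ℝ × ℝ) :=
  {q | 0 < q.1 ∧ q.2 ∈ Lam p F f c i j q.1}

section Region

variable {k : ℕ} {p : Matrix (Fin k) (Fin k) ℝ} {F f : Fin k → ℝ → ℝ} {c : ℝ}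

lemma rate_nonneg (hp : p ∈ Matrix.rowStochastic ℝ (Fin k))
    (hF : ∀ i, IsHoldingTimeDistribution (F i) (f i)) (i j : Fin k) {y : ℝ} (hy : 0 ≤ y) :
    0 ≤ rate p F f i j y :=
  mul_nonneg (hp.1 i j) ((hF i).hazard_nonneg hy)

/-- The diagonal interval has length zero, so unions and sums over `j ≠ i` may run over all `j`. -/
lemma Lam_self_eq_empty (hp0 : ∀ i, p i i = 0) (i : Fin k) (y : ℝ) : Lam p F f c i i y = ∅ := by
  simp [Lam, rate, hp0]

/-- The sum defining the later left end contains all terms of the earlier one and the rate of `(i,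
j)` itself; the remaining terms are nonnegative. -/
lemma leftEnd_add_rate_le (hp : p ∈ Matrix.rowStochastic ℝ (Fin k))
    (hF : ∀ i, IsHoldingTimeDistribution (F i) (f i)) {i j i' j' : Fin k} (hij : i ≠ j)
    (hlt : toLex (i, j) < toLex (i', j')) {y : ℝ} (hy : 0 ≤ y) :
    leftEnd p F f c i j y + rate p F f i j y ≤ leftEnd p F f c i' j' y := by
  rw [leftEnd, leftEnd, add_assoc]
  gcongr
  set A := Finset.univ.filter fun q : Fin k × Fin k => q.1 ≠ q.2 ∧ toLex q < toLex (i, j)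
  have hA : (i, j) ∉ A := by simp [A]
  rw [add_comm, ← Finset.sum_insert (f := fun q : Fin k × Fin k => rate p F f q.1 q.2 y) hA]
  refine Finset.sum_le_sum_of_subset_of_nonneg ?_ fun q _ _ => rate_nonneg hp hF _ _ hy
  intro q hq
  rcases Finset.mem_insert.1 hq with rfl | hq
  · simpa using ⟨hij, hlt⟩
  · simp only [A, Finset.mem_filter, Finset.mem_univ, true_and] at hq ⊢
    exact ⟨hq.1, hq.2.trans hlt⟩

lemma Lam_inj (hp : p ∈ Matrix.rowStochastic ℝ (Fin k)) (hp0 : ∀ i, p i i = 0)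
    (hF : ∀ i, IsHoldingTimeDistribution (F i) (f i)) {i j j' : Fin k} {y z : ℝ} (hy : 0 ≤ y)
    (hj : z ∈ Lam p F f c i j y) (hj' : z ∈ Lam p F f c i j' y) : j = j' := by
  have key : ∀ {a b : Fin k}, z ∈ Lam p F f c i a y → z ∈ Lam p F f c i b y → ¬ a < b := by
    intro a b ha hb hab
    have hia : i ≠ a := by
      rintro rfl
      simp [Lam_self_eq_empty hp0] at ha
    have := leftEnd_add_rate_le (c := c) hp hF hia (Prod.Lex.toLex_lt_toLex.2
      (Or.inr ⟨rfl, hab⟩) : toLex (i, a) < toLex (i, b)) hy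
    exact absurd ha.2 (not_lt.2 (this.trans hb.1))
  exact le_antisymm (not_lt.1 (key hj' hj)) (not_lt.1 (key hj hj'))

/-- The density is controlled only on `[0, ∞)`; freezing the age at `0` below gives a function
continuous on the whole line, which suffices since regions contain positive ages only. -/
lemma continuous_rate_max (hF : ∀ i, IsHoldingTimeDistribution (F i) (f i)) (i j : Fin k) :
    Continuous fun s => rate p F f i j (max s 0) :=
  continuous_const.mul
    ((hF i).hazard_continuousOn.comp_continuous (by fun_prop) fun s => mem_Ici.2 (le_max_right _ _))

lemma continuous_leftEnd_max (hF : ∀ i, IsHoldingTimeDistribution (F i) (f i)) (i j : Fin k) :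
    Continuous fun s => leftEnd p F f c i j (max s 0) :=
  continuous_const.add (continuous_finsetSum _ fun _ _ => continuous_rate_max hF _ _)

lemma measurableSet_region (hF : ∀ i, IsHoldingTimeDistribution (F i) (f i)) (i j : Fin k) :
    MeasurableSet (region p F f c i j) := by
  have h1 := (continuous_leftEnd_max (p := p) (c := c) hF i j).measurable
  have h2 := (continuous_rate_max (p := p) hF i j).measurable
  have : region p F f c i j = {q : ℝ × ℝ | 0 < q.1} ∩
      ({q : ℝ × ℝ | leftEnd p F f c i j (max q.1 0) ≤ q.2} ∩
      {q : ℝ × ℝ | q.2 < leftEnd p F f c i j (max q.1 0) + rate p F f i j (max q.1 0)}) := by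
    ext q
    simp only [region, Lam, mem_ofPred_eq, mem_inter_iff, mem_Ico]
    refine and_congr_right fun h0 => ?_
    rw [max_eq_left h0.le]
  rw [this]
  exact (measurableSet_lt measurable_const measurable_fst).inter
    ((measurableSet_le (h1.comp measurable_fst) measurable_snd).inter
      (measurableSet_lt measurable_snd ((h1.comp measurable_fst).add (h2.comp measurable_fst))))

/-- The area of the part of a region between two ages. -/
lemma volume_region (hp : p ∈ Matrix.rowStochastic ℝ (Fin k))
    (hF : ∀ i, IsHoldingTimeDistribution (F i) (f i)) (i j : Fin k) {a b : ℝ} (ha : 0 ≤ a)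
    (hab : a ≤ b) :
    volume (region p F f c i j ∩ Ioc a b ×ˢ univ) =
      ENNReal.ofReal (p i j * (cumHazard (F i) b - cumHazard (F i) a)) := by
  have hm : MeasurableSet (region p F f c i j ∩ Ioc a b ×ˢ univ) :=
    (measurableSet_region hF i j).inter (measurableSet_Ioc.prod MeasurableSet.univ)
  rw [Measure.volume_eq_prod, Measure.prod_apply hm, ← (hF i).integral_hazard ha hab,
    ← integral_const_mul, ofReal_integral_eq_lintegral_ofReal
      (((hF i).integrableOn_hazard ha).const_mul _), ← lintegral_indicator measurableSet_Ioc]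
  · refine lintegral_congr fun s => ?_
    by_cases hs : s ∈ Ioc a b
    · rw [indicator_of_mem hs]
      have : Prod.mk s ⁻¹' (region p F f c i j ∩ Ioc a b ×ˢ univ) = Lam p F f c i j s := by
        ext z
        simp [region, hs, ha.trans_lt hs.1]
      rw [this, Lam, Real.volume_Ico, add_sub_cancel_left, rate]
    · rw [indicator_of_notMem hs]
      have : Prod.mk s ⁻¹' (region p F f c i j ∩ Ioc a b ×ˢ univ) = ∅ := by
        ext z
        simp only [mem_preimage, mem_inter_iff, mem_prod, mem_univ, and_true, mem_empty_iff_false,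
          iff_false, not_and]
        exact fun _ h => hs h
      rw [this, measure_empty]
  · filter_upwards [ae_restrict_mem measurableSet_Ioc] with s hs
    exact rate_nonneg hp hF i j (ha.trans hs.1.le)

lemma region_disjoint (hp : p ∈ Matrix.rowStochastic ℝ (Fin k)) (hp0 : ∀ i, p i i = 0)
    (hF : ∀ i, IsHoldingTimeDistribution (F i) (f i)) (i : Fin k) :
    Pairwise (Function.onFun Disjoint (region p F f c i)) := by
  intro j j' hjj'
  refine disjoint_left.2 fun q hq hq' => hjj' ?_
  exact Lam_inj hp hp0 hF hq.1.le hq.2 hq'.2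

/-- The regions are disjoint and the row of `p` sums to one, so the weights `p i j` disappear from
the total area. -/
lemma volume_iUnion_region (hp : p ∈ Matrix.rowStochastic ℝ (Fin k)) (hp0 : ∀ i, p i i = 0)
    (hF : ∀ i, IsHoldingTimeDistribution (F i) (f i)) (i : Fin k) {a b : ℝ} (ha : 0 ≤ a)
    (hab : a ≤ b) :
    volume ((⋃ j, region p F f c i j) ∩ Ioc a b ×ˢ univ) =
      ENNReal.ofReal (cumHazard (F i) b - cumHazard (F i) a) := by
  rw [iUnion_inter, measure_iUnion
    (fun j j' hjj' => (region_disjoint hp hp0 hF i hjj').mono inter_subset_left inter_subset_left)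
    (fun j => (measurableSet_region hF i j).inter (measurableSet_Ioc.prod MeasurableSet.univ)),
    tsum_fintype]
  simp_rw [volume_region hp hF i _ ha hab]
  have h0 : 0 ≤ cumHazard (F i) b - cumHazard (F i) a :=
    sub_nonneg.2 ((hF i).cumHazard_monotone hab)
  rw [← ENNReal.ofReal_sum_of_nonneg fun j _ => mul_nonneg (hp.1 i j) h0, ← Finset.sum_mul,
    Matrix.sum_row_of_mem_rowStochastic hp, one_mul]

end Region

/-! ### Poisson random measures: void probabilities and independence. -/

lemma comap_measure_eq {Ω G : Type*} [MeasurableSpace G] (M : Ω → Measure G) :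
    MeasurableSpace.comap M inferInstance =
      MeasurableSpace.comap (fun ω (s : {s : Set G // MeasurableSet s}) => M ω s.1)
        inferInstance := by
  change MeasurableSpace.comap M (⨆ (s : Set G) (_ : MeasurableSet s), _) =
    MeasurableSpace.comap _ (⨆ _, _)
  simp_rw [MeasurableSpace.comap_iSup, MeasurableSpace.comap_comp, iSup_subtype]
  rfl

/-- The σ-algebra on measures is generated by the evaluations at measurable sets, so a random
measure is a process indexed by these sets and finite-dimensional independence is enough. -/
lemma indepFun_measure_of_forall {Ω E E' : Type*} [MeasurableSpace Ω] [MeasurableSpace E]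
    [MeasurableSpace E'] {μ : Measure Ω} [IsProbabilityMeasure μ] {N : Ω → Measure E}
    {N' : Ω → Measure E'} (hN : Measurable N) (hN' : Measurable N')
    (h : ∀ (I : Finset {s : Set E // MeasurableSet s}) (J : Finset {s : Set E' // MeasurableSet s}),
      IndepFun (fun ω (i : I) => N ω i.1.1) (fun ω (j : J) => N' ω j.1.1) μ) :
    IndepFun N N' μ := by
  have key := IndepFun.process_indepFun_process (P := μ)
    (X := fun (s : {s : Set E // MeasurableSet s}) ω => N ω s.1)
    (Y := fun (s : {s : Set E' // MeasurableSet s}) ω => N' ω s.1)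
    (fun s => (Measure.measurable_coe s.2).comp hN) (fun s => (Measure.measurable_coe s.2).comp hN') h
  rw [IndepFun_iff_Indep] at key ⊢
  rwa [comap_measure_eq N, comap_measure_eq N']

namespace IsPoissonRandomMeasure

variable {Ω E : Type*} [MeasurableSpace Ω] [MeasurableSpace E] {μ : Measure Ω}
  {N : Ω → Measure E} {ν : Measure E}

lemma measurable_apply (hN : IsPoissonRandomMeasure μ N ν) {B : Set E} (hB : MeasurableSet B) :
    Measurable fun ω => N ω B :=
  (Measure.measurable_coe hB).comp hN.measurable

lemma measure_eq_zero (hN : IsPoissonRandomMeasure μ N ν) {B : Set E} (hB : MeasurableSet B)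
    (hfin : ν B ≠ ∞) : μ {ω | N ω B = 0} = ENNReal.ofReal (Real.exp (-(ν B).toReal)) := by
  have := hN.law B hB hfin 0
  rw [poissonMeasure_singleton] at this
  simpa [ENNReal.toReal] using this

lemma iIndepFun_preimage (hN : IsPoissonRandomMeasure μ N ν) {ι : Type*} [Finite ι]
    [MeasurableSpace ι] [MeasurableSingletonClass ι] {φ : E → ι} (hφ : Measurable φ) :
    iIndepFun (fun v ω => N ω (φ ⁻¹' {v})) μ := by
  obtain ⟨m, ⟨ε⟩⟩ := Finite.exists_equiv_fin ι
  have := hN.indep m (fun l => φ ⁻¹' {ε.symm l}) (fun l => hφ (measurableSet_singleton _))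
    (fun a b hab => by
      refine Disjoint.preimage _ ?_
      simpa using hab)
  have h2 := this.precomp (g := ε) ε.injective
  simpa using h2

variable [IsProbabilityMeasure μ]

lemma ae_ne_top (hN : IsPoissonRandomMeasure μ N ν) {B : Set E} (hB : MeasurableSet B)
    (hfin : ν B ≠ ∞) : ∀ᵐ ω ∂μ, N ω B ≠ ∞ := by
  have hm : ∀ n : ℕ, MeasurableSet {ω | N ω B = (n : ℝ≥0∞)} := fun n =>
    hN.measurable_apply hB (measurableSet_singleton _)
  have h1 : μ (⋃ n : ℕ, {ω | N ω B = (n : ℝ≥0∞)}) = 1 := by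
    rw [measure_iUnion _ hm]
    · simp_rw [hN.law B hB hfin]
      have := measure_iUnion (μ := poissonMeasure (ν B).toNNReal) (f := fun n : ℕ => ({n} : Set ℕ))
        (fun a b hab => by simpa [Function.onFun] using hab) (fun n => measurableSet_singleton n)
      rw [← this, iUnion_of_singleton, measure_univ]
    · intro a b hab
      refine disjoint_left.2 fun ω h1 h2 => hab ?_
      have h3 : (a : ℝ≥0∞) = b := by rw [← show N ω B = a from h1, ← show N ω B = b from h2]
      exact_mod_cast h3
  have h2 : ∀ᵐ ω ∂μ, ω ∈ ⋃ n : ℕ, {ω | N ω B = (n : ℝ≥0∞)} := by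
    rw [← prob_compl_eq_zero_iff (MeasurableSet.iUnion hm)] at h1
    exact h1
  filter_upwards [h2] with ω hω
  obtain ⟨n, hn⟩ := mem_iUnion.1 hω
  rw [show N ω B = n from hn]
  exact ENNReal.natCast_ne_top n

lemma measure_two_le (hN : IsPoissonRandomMeasure μ N ν) {B : Set E} (hB : MeasurableSet B)
    (hfin : ν B ≠ ∞) :
    μ {ω | N ω B ≠ 0 ∧ N ω B ≠ 1} ≤ ENNReal.ofReal ((ν B).toReal ^ 2) := by
  have h0 := hN.law B hB hfin 0
  have h1 := hN.law B hB hfin 1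
  rw [poissonMeasure_singleton] at h0 h1
  set r : ℝ := (ν B).toReal with hr
  have hr' : (((ν B).toNNReal : NNReal) : ℝ) = r := rfl
  have hr0 : 0 ≤ r := ENNReal.toReal_nonneg
  simp only [hr', Nat.cast_zero, pow_zero, mul_one, Nat.factorial_zero, Nat.cast_one, div_one,
    pow_one, Nat.factorial_one] at h0 h1
  have hm0 : MeasurableSet {ω | N ω B = 0} := hN.measurable_apply hB (measurableSet_singleton _)
  have hm1 : MeasurableSet {ω | N ω B = 1} := hN.measurable_apply hB (measurableSet_singleton _)
  have hd : Disjoint {ω | N ω B = 0} {ω | N ω B = 1} := by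
    refine disjoint_left.2 fun ω h1 h2 => ?_
    rw [mem_ofPred_eq] at h1 h2
    rw [h1] at h2
    exact zero_ne_one h2
  have hu : {ω | N ω B ≠ 0 ∧ N ω B ≠ 1} = ({ω | N ω B = 0} ∪ {ω | N ω B = 1})ᶜ := by
    ext ω
    simp
  have he : 0 ≤ Real.exp (-r) := (Real.exp_pos _).le
  rw [hu, prob_compl_eq_one_sub (hm0.union hm1), measure_union hd hm1, h0, h1,
    ← ENNReal.ofReal_add he (mul_nonneg he hr0), ← ENNReal.ofReal_one,
    ← ENNReal.ofReal_sub _ (add_nonneg he (mul_nonneg he hr0))]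
  refine ENNReal.ofReal_le_ofReal ?_
  have h2 : 1 - r ≤ Real.exp (-r) := Real.one_sub_le_exp_neg r
  -- Multiplying `1 - r ≤ exp (-r)` by `1 + r` gives `1 - exp (-r) (1 + r) ≤ r ^ 2`.
  nlinarith [mul_le_mul_of_nonneg_right h2 (show 0 ≤ 1 + r by linarith)]

/-- The restrictions of a Poisson random measure to a set and to its complement are independent. -/
lemma indepFun_restrict (hN : IsPoissonRandomMeasure μ N ν) {D : Set E} (hD : MeasurableSet D) :
    IndepFun (fun ω => (N ω).restrict D) (fun ω => (N ω).restrict Dᶜ) μ := by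
  classical
  have hr : ∀ D : Set E, MeasurableSet D → Measurable fun ω => (N ω).restrict D := fun D hD =>
    Measure.measurable_of_measurable_coe _ fun s hs => by
      simp_rw [Measure.restrict_apply hs]
      exact hN.measurable_apply (hs.inter hD)
  refine indepFun_measure_of_forall (hr D hD) (hr Dᶜ hD.compl) fun I J => ?_
  let K := I ∪ J
  -- The fibres of `φ` are the atoms generated by `D` and the finitely many test sets. Counts on
  -- atoms are independent, every test set cut with `D` is a union of atoms in `S`, and cut with
  -- `Dᶜ` a union of atoms in `T`.
  let φ : E → Prop × (K → Prop) := fun x => (x ∈ D, fun s => x ∈ s.1.1)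
  have hφ : Measurable φ := by
    refine Measurable.prodMk (measurableSet_setOfPred.1 hD) (measurable_pi_lambda _ fun s => ?_)
    exact measurableSet_setOfPred.1 s.1.2
  have hind := hN.iIndepFun_preimage hφ
  have hmeas : ∀ v, Measurable fun ω => N ω (φ ⁻¹' {v}) := fun v =>
    hN.measurable_apply (hφ (measurableSet_singleton _))
  let S : Finset (Prop × (K → Prop)) := Finset.univ.filter fun v => v.1
  let T : Finset (Prop × (K → Prop)) := Finset.univ.filter fun v => ¬ v.1
  have hST : Disjoint S T := Finset.disjoint_filter_filter_not _ _ _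
  have h1 := hind.indepFun_finset S T hST hmeas
  have key : ∀ (L : Finset {s : Set E // MeasurableSet s}) (hL : L ⊆ K)
      (U : Finset (Prop × (K → Prop))) (C : Set E) (hC : C = φ ⁻¹' U) (ω : Ω) (i : L),
      ∑ v : U, (if v.1.2 ⟨i.1, hL i.2⟩ then N ω (φ ⁻¹' {v.1}) else 0) = N ω (i.1.1 ∩ C) := by
    intro L hL U C hC ω i
    rw [Finset.sum_coe_sort U fun v => if v.2 ⟨i.1, hL i.2⟩ then N ω (φ ⁻¹' {v}) else 0,
      ← Finset.sum_filter, sum_measure_preimage_singleton _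
        fun v _ => hφ (measurableSet_singleton _), hC]
    congr 1
    ext x
    simp [φ, and_comm]
  have h2 := h1.comp
    (φ := fun a (i : I) => ∑ v : S, if v.1.2 ⟨i.1, Finset.subset_union_left i.2⟩ then a v else 0)
    (ψ := fun a (i : J) => ∑ v : T, if v.1.2 ⟨i.1, Finset.subset_union_right i.2⟩ then a v else 0)
    (measurable_pi_lambda _ fun i => Finset.measurable_sum _ fun v _ => by
      split_ifs <;> fun_prop)
    (measurable_pi_lambda _ fun i => Finset.measurable_sum _ fun v _ => by
      split_ifs <;> fun_prop)
  convert h2 using 1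
  · ext ω i
    rw [Measure.restrict_apply i.1.2]
    exact (key I Finset.subset_union_left S D (by ext x; simp [S, φ]) ω i).symm
  · ext ω i
    rw [Measure.restrict_apply i.1.2]
    exact (key J Finset.subset_union_right T Dᶜ (by ext x; simp [T, φ]) ω i).symm

end IsPoissonRandomMeasure

lemma measurable_restrict {E : Type*} [MeasurableSpace E] {D : Set E} (hD : MeasurableSet D) :
    Measurable fun M : Measure E => M.restrict D :=
  Measure.measurable_of_measurable_coe _ fun s hs => by
    simp_rw [Measure.restrict_apply hs]
    exact Measure.measurable_coe (hs.inter hD)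

/-- Both hypotheses together say that the joint law is a triple product, and products are
associative. Used with `U` the initial state and `V`, `W` the points before and after a fixed time.
-/
lemma indepFun_prodMk_left {Ω α β γ : Type*} [MeasurableSpace Ω] [MeasurableSpace α]
    [MeasurableSpace β] [MeasurableSpace γ] {μ : Measure Ω} [IsProbabilityMeasure μ]
    {U : Ω → α} {V : Ω → β} {W : Ω → γ} (hU : Measurable U) (hV : Measurable V) (hW : Measurable W)
    (h : IndepFun U (fun ω => (V ω, W ω)) μ) (h' : IndepFun V W μ) :
    IndepFun (fun ω => (U ω, V ω)) W μ := by
  have hUV : IndepFun U V μ := h.comp (φ := id) measurable_id measurable_fst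
  rw [indepFun_iff_map_prod_eq_prod_map_map (by fun_prop) (by fun_prop)] at h h' hUV ⊢
  have := Measure.isProbabilityMeasure_map (μ := μ) hU.aemeasurable
  have := Measure.isProbabilityMeasure_map (μ := μ) hV.aemeasurable
  have := Measure.isProbabilityMeasure_map (μ := μ) hW.aemeasurable
  rw [hUV, ← MeasurableEquiv.prodAssoc.map_measurableEquiv_injective.eq_iff,
    Measure.prodAssoc_prod, ← h', ← h, Measure.map_map (by fun_prop) (by fun_prop)]
  rfl

/-! ### Absence of simultaneous points. -/

section Intensity

lemma intensity_le_volume (B : Set (ℝ × ℝ)) : intensity B ≤ volume B :=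
  Measure.restrict_apply_le _ _

variable {Ω : Type*} [MeasurableSpace Ω] {μ : Measure Ω} [IsProbabilityMeasure μ]
  {N : Ω → Measure (ℝ × ℝ)}

/-- Cut the slab into `m` strips of area `2 K ^ 2 / m`. Some strip has two or more points with
probability at most `m (2 K ^ 2 / m) ^ 2 = 4 K ^ 4 / m`, which tends to `0`; so almost surely some
partition has at most one point in each strip. -/
lemma IsPoissonRandomMeasure.ae_slab_le_one (hN : IsPoissonRandomMeasure μ N intensity) (K : ℕ) :
    ∀ᵐ ω ∂μ, ∀ u ∈ Ioc (0 : ℝ) K, N ω ({u} ×ˢ Icc (-(K : ℝ)) K) ≤ 1 := by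
  rcases Nat.eq_zero_or_pos K with rfl | hK
  · simp
  have hK' : (0 : ℝ) < K := by exact_mod_cast hK
  let S : ℕ → ℕ → Set (ℝ × ℝ) := fun m l =>
    Ioc (l * (K / m : ℝ)) ((l + 1) * (K / m : ℝ)) ×ˢ Icc (-(K : ℝ)) K
  have hS : ∀ m l, MeasurableSet (S m l) := fun m l => measurableSet_Ioc.prod measurableSet_Icc
  have hvol : ∀ m l, volume (S m l) = ENNReal.ofReal (2 * (K : ℝ) ^ 2 / m) := by
    intro m l
    rw [Measure.volume_eq_prod, Measure.prod_prod, Real.volume_Ioc, Real.volume_Icc,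
      ← ENNReal.ofReal_mul]
    · congr 1
      ring
    · have : 0 ≤ (K / m : ℝ) := by positivity
      linarith
  let A : ℕ → Set Ω := fun m => ⋃ l ∈ Finset.range m, {ω | N ω (S m l) ≠ 0 ∧ N ω (S m l) ≠ 1}
  have hA : ∀ m, 0 < m → μ (A m) ≤ ENNReal.ofReal (4 * (K : ℝ) ^ 4 / m) := by
    intro m hm
    have hm' : (0 : ℝ) < m := by exact_mod_cast hm
    calc μ (A m) ≤ ∑ l ∈ Finset.range m, μ {ω | N ω (S m l) ≠ 0 ∧ N ω (S m l) ≠ 1} :=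
          measure_biUnion_finset_le _ _
      _ ≤ ∑ l ∈ Finset.range m, ENNReal.ofReal ((2 * (K : ℝ) ^ 2 / m) ^ 2) := by
          refine Finset.sum_le_sum fun l _ => ?_
          have hle := (intensity_le_volume (S m l)).trans_eq (hvol m l)
          refine (hN.measure_two_le (hS m l) (ne_top_of_le_ne_top ENNReal.ofReal_ne_top hle)).trans ?_
          refine ENNReal.ofReal_le_ofReal (pow_le_pow_left₀ ENNReal.toReal_nonneg ?_ 2)
          exact ENNReal.toReal_le_of_le_ofReal (by positivity) hle
      _ = ENNReal.ofReal (4 * (K : ℝ) ^ 4 / m) := by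
          rw [Finset.sum_const, Finset.card_range, nsmul_eq_mul, ← ENNReal.ofReal_natCast,
            ← ENNReal.ofReal_mul (by positivity)]
          congr 1
          field_simp
          ring
  have h0 : μ (⋂ m : ℕ, A (m + 1)) = 0 := by
    have hlim : Tendsto (fun m : ℕ => ENNReal.ofReal (4 * (K : ℝ) ^ 4 / (m + 1 : ℕ))) atTop (𝓝 0) := by
      rw [← ENNReal.ofReal_zero]
      refine ENNReal.tendsto_ofReal ?_
      exact (tendsto_const_div_atTop_nhds_zero_nat _).comp (tendsto_add_atTop_nat 1)
    refine le_antisymm (ge_of_tendsto' hlim fun m => ?_) (zero_le)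
    exact (measure_mono (iInter_subset _ m)).trans (hA _ m.succ_pos)
  have h1 : ∀ᵐ ω ∂μ, ω ∉ ⋂ m : ℕ, A (m + 1) := measure_eq_zero_iff_ae_notMem.1 h0
  filter_upwards [h1] with ω hω u hu
  simp only [mem_iInter, not_forall, A, mem_iUnion, not_exists] at hω
  obtain ⟨m, hm⟩ := hω
  have hm' : (0 : ℝ) < (m + 1 : ℕ) := by positivity
  have hd : 0 < (K / (m + 1 : ℕ) : ℝ) := by positivity
  set d := (K / (m + 1 : ℕ) : ℝ) with hd_def
  have hKd : (K : ℝ) = (m + 1 : ℕ) * d := by rw [hd_def]; field_simp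
  have hpos : 0 < u / d := div_pos hu.1 hd
  have hc : 0 < ⌈u / d⌉₊ := Nat.ceil_pos.2 hpos
  obtain ⟨l, hl⟩ := Nat.exists_eq_succ_of_ne_zero hc.ne'
  have h2 : u / d ≤ (l + 1 : ℝ) := by
    have := Nat.le_ceil (u / d)
    rw [hl] at this
    exact_mod_cast this
  have h3 : (l : ℝ) < u / d := Nat.lt_ceil.1 (by omega)
  have h4 : l < m + 1 := by
    have : u / d ≤ (m + 1 : ℕ) := by
      rw [div_le_iff₀ hd, ← hKd]
      exact hu.2
    exact_mod_cast h3.trans_le this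
  have hsub : ({u} ×ˢ Icc (-(K : ℝ)) K : Set (ℝ × ℝ)) ⊆ S (m + 1) l := by
    refine prod_mono (singleton_subset_iff.2 ⟨?_, ?_⟩) subset_rfl
    · exact (lt_div_iff₀ hd).1 h3
    · exact (div_le_iff₀ hd).1 h2
  refine (measure_mono hsub).trans ?_
  have := hm l (Finset.mem_range.2 h4)
  rw [mem_ofPred_eq, not_and_or, not_not, not_not] at this
  rcases this with h | h <;> simp [h]

lemma IsPoissonRandomMeasure.ae_Iic_zero (hN : IsPoissonRandomMeasure μ N intensity) :
    ∀ᵐ ω ∂μ, N ω (Iic 0 ×ˢ univ) = 0 := by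
  have hm : MeasurableSet (Iic (0 : ℝ) ×ˢ (univ : Set ℝ)) := measurableSet_Iic.prod MeasurableSet.univ
  have h0 : intensity (Iic (0 : ℝ) ×ˢ (univ : Set ℝ)) = 0 := by
    rw [intensity, Measure.restrict_apply hm]
    convert measure_empty (μ := (volume : Measure (ℝ × ℝ)))
    ext q
    simp +contextual [not_lt]
  have h1 := hN.measure_eq_zero hm (by simp [h0])
  rw [h0] at h1
  simp only [ENNReal.toReal_zero, neg_zero, Real.exp_zero, ENNReal.ofReal_one] at h1
  exact (prob_compl_eq_zero_iff (hN.measurable_apply hm (measurableSet_singleton 0))).2 h1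

/-- Almost surely no two points of the Poisson random measure occur at the same time. -/
lemma IsPoissonRandomMeasure.ae_slice (hN : IsPoissonRandomMeasure μ N intensity) :
    ∀ᵐ ω ∂μ, ∀ u : ℝ, N ω ({u} ×ˢ univ) = 0 ∨
      ∃ z, (N ω).restrict ({u} ×ˢ univ) = Measure.dirac (u, z) := by
  filter_upwards [ae_all_iff.2 hN.ae_slab_le_one, hN.ae_Iic_zero, hN.integerValued] with ω h1 h0 hint u
  have hm : MeasurableSet ({u} ×ˢ univ : Set (ℝ × ℝ)) :=
    (measurableSet_singleton u).prod MeasurableSet.univ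
  rcases le_or_gt u 0 with hu | hu
  · left
    refine measure_mono_null (prod_mono (singleton_subset_iff.2 hu) subset_rfl) h0
  have hle : N ω ({u} ×ˢ univ) ≤ 1 := by
    have hU : ({u} ×ˢ univ : Set (ℝ × ℝ)) = ⋃ K : ℕ, {u} ×ˢ Icc (-(K : ℝ)) K := by
      ext q
      simp only [mem_prod, mem_singleton_iff, mem_univ, and_true, mem_iUnion, mem_Icc,
        exists_and_left, iff_self_and]
      intro _
      obtain ⟨K, hK⟩ := exists_nat_ge |q.2|
      exact ⟨K, abs_le.1 hK⟩
    have hmono : Monotone fun K : ℕ => ({u} ×ˢ Icc (-(K : ℝ)) K : Set (ℝ × ℝ)) := by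
      intro a b hab
      have : (a : ℝ) ≤ b := by exact_mod_cast hab
      exact prod_mono subset_rfl (Icc_subset_Icc (neg_le_neg this) this)
    have ht := tendsto_measure_iUnion_atTop (μ := N ω) hmono
    rw [← hU] at ht
    refine le_of_tendsto ht ?_
    obtain ⟨K, hK⟩ := exists_nat_ge u
    filter_upwards [eventually_ge_atTop K] with L hL
    exact h1 L u ⟨hu, hK.trans (by exact_mod_cast hL)⟩
  have h01 : ∀ s, MeasurableSet s → (N ω).restrict ({u} ×ˢ univ) s = 0 ∨
      (N ω).restrict ({u} ×ˢ univ) s = 1 := by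
    intro s hs
    obtain ⟨n, hn⟩ := hint (s ∩ {u} ×ˢ univ) (hs.inter hm)
    have h2 : (n : ℝ≥0∞) ≤ 1 := hn ▸ (measure_mono inter_subset_right).trans hle
    rw [Measure.restrict_apply hs, hn]
    have h3 : n ≤ 1 := by exact_mod_cast h2
    rcases Order.le_one_iff.1 h3 with rfl | rfl <;> simp
  by_cases hz : N ω ({u} ×ˢ univ) = 0
  · exact Or.inl hz
  right
  -- A nonzero measure on the plane with values `0` and `1` only is a Dirac mass.
  have : IsZeroOneMeasure ((N ω).restrict ({u} ×ˢ univ)) := ⟨fun s hs => h01 s hs⟩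
  have : NeZero ((N ω).restrict ({u} ×ˢ univ)) := ⟨by rwa [Ne, Measure.restrict_eq_zero]⟩
  obtain ⟨q, hq⟩ := IsZeroOneMeasure.exists_eq_dirac (μ := (N ω).restrict ({u} ×ˢ univ))
  have hqu : q.1 = u := by
    have h3 : (N ω).restrict ({u} ×ˢ univ) ({u} ×ˢ univ)ᶜ = 0 := by
      rw [Measure.restrict_apply hm.compl]
      simp
    rw [hq, Measure.dirac_apply' _ hm.compl] at h3
    by_contra hne
    simp [indicator, hne] at h3
  exact ⟨q.2, by rw [hq, ← hqu]⟩

end Intensity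

/-! ### Measurability of void events with random sets. -/

/-- An exhausting sequence of bounded sets. -/
def box (n : ℕ) : Set (ℝ × ℝ) := Icc (-(n : ℝ)) n ×ˢ Icc (-(n : ℝ)) n

lemma measurableSet_box (n : ℕ) : MeasurableSet (box n) := measurableSet_Icc.prod measurableSet_Icc

lemma iUnion_box : ⋃ n, box n = univ := by
  refine eq_univ_of_forall fun q => mem_iUnion.2 ?_
  obtain ⟨n, hn⟩ := exists_nat_ge (max |q.1| |q.2|)
  exact ⟨n, abs_le.1 ((le_max_left _ _).trans hn), abs_le.1 ((le_max_right _ _).trans hn)⟩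

/-- A measure that is finite on bounded sets. -/
def LocFinite (M : Measure (ℝ × ℝ)) : Prop := ∀ n, M (box n) ≠ ∞

/-- A form of `M B = 0` that depends measurably on `M` and on parameters of `B`. -/
def Avoids (M : Measure (ℝ × ℝ)) (B : Set (ℝ × ℝ)) : Prop :=
  ∀ n, (1 + M (box n))⁻¹ * M (B ∩ box n) = 0

lemma avoids_iff {M : Measure (ℝ × ℝ)} (hM : LocFinite M) {B : Set (ℝ × ℝ)} :
    Avoids M B ↔ M B = 0 := by
  have h1 : Avoids M B ↔ ∀ n, M (B ∩ box n) = 0 := by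
    refine forall_congr' fun n => ?_
    rw [mul_eq_zero, or_iff_right]
    exact ENNReal.inv_ne_zero.2 (ENNReal.add_ne_top.2 ⟨ENNReal.one_ne_top, hM n⟩)
  rw [h1, ← measure_iUnion_null_iff, ← inter_iUnion, iUnion_box, inter_univ]

lemma LocFinite.restrict {M : Measure (ℝ × ℝ)} (hM : LocFinite M) (D : Set (ℝ × ℝ)) :
    LocFinite (M.restrict D) := fun n =>
  ne_top_of_le_ne_top (hM n) (Measure.restrict_apply_le _ _)

lemma measurableSet_avoids {S : Type*} [MeasurableSpace S] {B : Set (S × (ℝ × ℝ))}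
    (hB : MeasurableSet B) :
    MeasurableSet {w : S × Measure (ℝ × ℝ) | Avoids w.2 (Prod.mk w.1 ⁻¹' B)} := by
  simp only [Avoids, Set.ofPred_forall]
  refine MeasurableSet.iInter fun n => ?_
  -- The normalisation makes `κ` a finite kernel, for which the measure of a section depends
  -- measurably on its parameters. If `M (box n) = ∞` the factor is `0` and the condition is void,
  -- so `Avoids` has its intended meaning only for locally finite `M`.
  let κ : Kernel (Measure (ℝ × ℝ)) (ℝ × ℝ) :=
    { toFun := fun M => (1 + M (box n))⁻¹ • M.restrict (box n)
      measurable' := by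
        refine Measure.measurable_of_measurable_coe _ fun s hs => ?_
        simp_rw [Measure.smul_apply, Measure.restrict_apply hs, smul_eq_mul]
        exact ((Measure.measurable_coe (measurableSet_box n)).const_add 1).inv.mul
          (Measure.measurable_coe (hs.inter (measurableSet_box n))) }
  have hκ : ∀ M : Measure (ℝ × ℝ), κ M = (1 + M (box n))⁻¹ • M.restrict (box n) := fun _ => rfl
  have : IsFiniteKernel κ := by
    refine ⟨1, ENNReal.one_lt_top, fun M => ?_⟩
    rw [hκ, Measure.smul_apply, Measure.restrict_apply_univ, smul_eq_mul, mul_comm,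
      ← div_eq_mul_inv]
    exact ENNReal.div_le_of_le_mul (by simp)
  have h1 := Kernel.measurable_kernel_prodMk_left
    (κ := κ.comap (Prod.snd : S × Measure (ℝ × ℝ) → _) measurable_snd)
    (t := {x : (S × Measure (ℝ × ℝ)) × (ℝ × ℝ) | (x.1.1, x.2) ∈ B})
    (hB.preimage (by fun_prop : Measurable fun x : (S × Measure (ℝ × ℝ)) × (ℝ × ℝ) =>
      (x.1.1, x.2)))
  convert h1 (measurableSet_singleton 0) using 1
  ext w
  have hs : MeasurableSet (Prod.mk w.1 ⁻¹' B) := hB.preimage measurable_prodMk_left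
  change _ = 0 ↔ (κ w.2) (Prod.mk w.1 ⁻¹' B) = 0
  rw [hκ, Measure.smul_apply, Measure.restrict_apply hs, smul_eq_mul]

/-- Translation in time. -/
def shift (t : ℝ) (Q : Set (ℝ × ℝ)) : Set (ℝ × ℝ) := {w | (w.1 - t, w.2) ∈ Q}

/-- The part of the translate of `Q` by `t` in the time interval `(t, b]`. -/
def window (Q : Set (ℝ × ℝ)) (t b : ℝ) : Set (ℝ × ℝ) := shift t Q ∩ Ioc t b ×ˢ univ

lemma measurableSet_shift {Q : Set (ℝ × ℝ)} (hQ : MeasurableSet Q) (t : ℝ) :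
    MeasurableSet (shift t Q) :=
  hQ.preimage (by fun_prop : Measurable fun w : ℝ × ℝ => (w.1 - t, w.2))

lemma measurableSet_window {Q : Set (ℝ × ℝ)} (hQ : MeasurableSet Q) (t b : ℝ) :
    MeasurableSet (window Q t b) :=
  (measurableSet_shift hQ t).inter (measurableSet_Ioc.prod MeasurableSet.univ)

lemma window_mono_right (Q : Set (ℝ × ℝ)) (t : ℝ) {b b' : ℝ} (hb : b ≤ b') :
    window Q t b ⊆ window Q t b' :=
  inter_subset_inter_right _ (prod_mono (Ioc_subset_Ioc_right hb) subset_rfl)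

lemma measurableSet_uncurry_window {S : Type*} [MeasurableSpace S] {k : ℕ}
    {Q : Fin k → Set (ℝ × ℝ)} (hQ : ∀ i, MeasurableSet (Q i)) {i : S → Fin k} (hi : Measurable i)
    {t b : S → ℝ} (ht : Measurable t) (hb : Measurable b) :
    MeasurableSet {x : S × (ℝ × ℝ) | x.2 ∈ window (Q (i x.1)) (t x.1) (b x.1)} := by
  have : {x : S × (ℝ × ℝ) | x.2 ∈ window (Q (i x.1)) (t x.1) (b x.1)} =
      (⋃ a, {x | i x.1 = a} ∩ (fun x : S × (ℝ × ℝ) => (x.2.1 - t x.1, x.2.2)) ⁻¹' Q a) ∩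
      ({x | t x.1 < x.2.1} ∩ {x | x.2.1 ≤ b x.1}) := by
    ext x
    simp [window, shift]
  rw [this]
  refine MeasurableSet.inter (MeasurableSet.iUnion fun a => ?_) ?_
  · exact ((measurableSet_singleton a).preimage (hi.comp measurable_fst)).inter
      ((hQ a).preimage (by fun_prop))
  · exact (measurableSet_lt (by fun_prop) (by fun_prop)).inter
      (measurableSet_le (by fun_prop) (by fun_prop))

/-! ### Transition times and states as a functional of the point configuration. -/

section Trajectory

variable {k : ℕ}

open Classical in
/-- The first time after `s.2` at which `M` has a point in the translate by `s.2` of one of the sets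
`R s.1 j`. -/
noncomputable def nextTime (R : Fin k → Fin k → Set (ℝ × ℝ)) (s : Fin k × EReal)
    (M : Measure (ℝ × ℝ)) : EReal :=
  ⨅ q : ℚ, if s.2 < ((q : ℝ) : EReal) ∧ ¬ Avoids M (window (⋃ j, R s.1 j) s.2.toReal q) then
    ((q : ℝ) : EReal) else ⊤

open Classical in
/-- Some index that satisfies `P`, and `i` if there is none. -/
noncomputable def select (i : Fin k) (P : Fin k → Prop) : Fin k :=
  if h : ∃ j, P j then h.choose else i

/-- The index `j` of the set `R s.1 j` in which `M` has a point at the time `nextTime R s M`. -/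
noncomputable def nextState (R : Fin k → Fin k → Set (ℝ × ℝ)) (s : Fin k × EReal)
    (M : Measure (ℝ × ℝ)) : Fin k :=
  select s.1 fun j => ¬ Avoids M (window (R s.1 j) s.2.toReal (nextTime R s M).toReal)

/-- The successive states and transition times driven by `M`, starting from `x` at time `0`. -/
noncomputable def traj (R : Fin k → Fin k → Set (ℝ × ℝ)) (x : Fin k) (M : Measure (ℝ × ℝ)) :
    ℕ → Fin k × EReal
  | 0 => (x, 0)
  | n + 1 => (nextState R (traj R x M n) M, nextTime R (traj R x M n) M)

variable {R : Fin k → Fin k → Set (ℝ × ℝ)}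

/-- This is why `nextTime` is an infimum over rational times: it is countable, and each condition is
a measurable void event. -/
lemma measurable_nextTime (hR : ∀ i j, MeasurableSet (R i j)) :
    Measurable fun w : (Fin k × EReal) × Measure (ℝ × ℝ) => nextTime R w.1 w.2 := by
  refine Measurable.iInf fun q => Measurable.ite ?_ measurable_const measurable_const
  refine (measurableSet_lt measurable_fst.snd measurable_const).inter (MeasurableSet.compl ?_)
  exact measurableSet_avoids (measurableSet_uncurry_window (S := Fin k × EReal)
    (fun i => MeasurableSet.iUnion (hR i)) measurable_fst measurable_snd.ereal_toReal
    measurable_const)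

lemma measurable_nextState (hR : ∀ i j, MeasurableSet (R i j)) :
    Measurable fun w : (Fin k × EReal) × Measure (ℝ × ℝ) => nextState R w.1 w.2 := by
  have h1 : Measurable fun w : Fin k × (Fin k → Prop) => select w.1 w.2 := Measurable.of_discrete
  have h2 : ∀ j, MeasurableSet {w : ((Fin k × EReal) × EReal) × Measure (ℝ × ℝ) |
      Avoids w.2 (window (R w.1.1.1 j) w.1.1.2.toReal w.1.2.toReal)} := fun j =>
    measurableSet_avoids (measurableSet_uncurry_window
      (S := (Fin k × EReal) × EReal) (Q := fun i => R i j) (fun i => hR i j)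
      (i := fun s => s.1.1) (by fun_prop) (t := fun s => s.1.2.toReal)
      (measurable_fst.snd.ereal_toReal)
      (b := fun s => s.2.toReal) (measurable_snd.ereal_toReal))
  have h3 : Measurable fun w : (Fin k × EReal) × Measure (ℝ × ℝ) =>
      ((w.1, nextTime R w.1 w.2), w.2) :=
    (measurable_fst.prodMk (measurable_nextTime hR)).prodMk measurable_snd
  have h4 : Measurable fun w : (Fin k × EReal) × Measure (ℝ × ℝ) => fun j : Fin k =>
      ¬ Avoids w.2 (window (R w.1.1 j) w.1.2.toReal (nextTime R w.1 w.2).toReal) :=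
    measurable_pi_lambda _ fun j => measurableSet_setOfPred.1 ((h2 j).preimage h3).compl
  exact h1.comp (measurable_fst.fst.prodMk h4)

lemma measurable_traj (hR : ∀ i j, MeasurableSet (R i j)) (n : ℕ) :
    Measurable fun w : Fin k × Measure (ℝ × ℝ) => traj R w.1 w.2 n := by
  induction n with
  | zero => exact measurable_fst.prodMk measurable_const
  | succ n ih =>
    exact ((measurable_nextState hR).comp (ih.prodMk measurable_snd)).prodMk
      ((measurable_nextTime hR).comp (ih.prodMk measurable_snd))

lemma le_nextTime (s : Fin k × EReal) (M : Measure (ℝ × ℝ)) : s.2 ≤ nextTime R s M := by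
  refine le_iInf fun q => ?_
  split_ifs with h
  · exact h.1.le
  · exact le_top

lemma nextTime_lt_iff {s : Fin k × EReal} {M : Measure (ℝ × ℝ)} {e : EReal} :
    nextTime R s M < e ↔ ∃ q : ℚ, s.2 < ((q : ℝ) : EReal) ∧ ((q : ℝ) : EReal) < e ∧
      ¬ Avoids M (window (⋃ j, R s.1 j) s.2.toReal q) := by
  rw [nextTime, iInf_lt_iff]
  refine exists_congr fun q => ?_
  split_ifs with h
  · simp [h.1, h.2]
  · simp only [not_top_lt, false_iff]
    exact fun h' => h ⟨h'.1, h'.2.2⟩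

lemma traj_time_mono (x : Fin k) (M : Measure (ℝ × ℝ)) : Monotone fun n => (traj R x M n).2 :=
  monotone_nat_of_le_succ fun _ => le_nextTime _ _

lemma traj_time_nonneg (x : Fin k) (M : Measure (ℝ × ℝ)) (n : ℕ) : 0 ≤ (traj R x M n).2 :=
  traj_time_mono x M (Nat.zero_le n)

section Locality

variable {M : Measure (ℝ × ℝ)} {d : ℝ}

lemma avoids_restrict_iff (hM : LocFinite M) (hR : ∀ i j, MeasurableSet (R i j)) (i : Fin k)
    (t : ℝ) {b : ℝ} (hb : b ≤ d) :
    (∀ j, Avoids (M.restrict (Iic d ×ˢ univ)) (window (R i j) t b) ↔ Avoids M (window (R i j) t b))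
    ∧ (Avoids (M.restrict (Iic d ×ˢ univ)) (window (⋃ j, R i j) t b) ↔
      Avoids M (window (⋃ j, R i j) t b)) := by
  have key : ∀ Q : Set (ℝ × ℝ), MeasurableSet Q →
      (Avoids (M.restrict (Iic d ×ˢ univ)) (window Q t b) ↔ Avoids M (window Q t b)) := by
    intro Q hQ
    rw [avoids_iff hM, avoids_iff (hM.restrict _), Measure.restrict_apply (measurableSet_window hQ t b),
      inter_eq_left.2]
    exact fun w hw => ⟨hw.2.1.2.trans hb, mem_univ _⟩
  exact ⟨fun j => key _ (hR i j), key _ (MeasurableSet.iUnion (hR i))⟩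

/-- Whether the next time precedes `e ≤ d` is decided by windows that end before `e`, and these see
no point after `d`. -/
lemma nextTime_restrict_lt_iff (hM : LocFinite M) (hR : ∀ i j, MeasurableSet (R i j))
    (s : Fin k × EReal) {e : EReal} (he : e ≤ d) :
    nextTime R s (M.restrict (Iic d ×ˢ univ)) < e ↔ nextTime R s M < e := by
  rw [nextTime_lt_iff, nextTime_lt_iff]
  refine exists_congr fun q => and_congr_right fun _ => and_congr_right fun hq => not_congr ?_
  exact (avoids_restrict_iff hM hR _ _ (EReal.coe_le_coe_iff.1 (hq.le.trans he))).2

lemma nextTime_restrict (hM : LocFinite M) (hR : ∀ i j, MeasurableSet (R i j))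
    {s : Fin k × EReal} (hs : nextTime R s M < d) :
    nextTime R s (M.restrict (Iic d ×ˢ univ)) = nextTime R s M := by
  have h1 := fun e (he : e ≤ (d : EReal)) => nextTime_restrict_lt_iff hM hR s he
  refine le_antisymm (not_lt.1 fun h => ?_) (not_lt.1 fun h => ?_)
  · exact absurd ((h1 _ ((h1 d le_rfl).2 hs).le).2 h) (lt_irrefl _)
  · exact absurd ((h1 _ hs.le).1 h) (lt_irrefl _)

lemma nextState_restrict (hM : LocFinite M) (hR : ∀ i j, MeasurableSet (R i j))
    {s : Fin k × EReal} (h0 : 0 ≤ s.2) (hs : nextTime R s M < d) :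
    nextState R s (M.restrict (Iic d ×ˢ univ)) = nextState R s M := by
  rw [nextState, nextState, nextTime_restrict hM hR hs]
  congr 1
  ext j
  refine not_congr ((avoids_restrict_iff hM hR _ _ ?_).1 j)
  have h1 : 0 ≤ nextTime R s M := h0.trans (le_nextTime s M)
  exact EReal.coe_le_coe_iff.1
    ((EReal.coe_toReal hs.ne_top (ne_bot_of_le_ne_bot EReal.zero_ne_bot h1)).trans_le hs.le)

/-- The stopping time property: points up to `d` decide whether the `n`-th transition precedes `d`,
and if so they determine the trajectory up to it. -/
lemma traj_restrict (hM : LocFinite M) (hR : ∀ i j, MeasurableSet (R i j)) (x : Fin k) (n : ℕ) :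
    ((traj R x (M.restrict (Iic d ×ˢ univ)) n).2 < d ↔ (traj R x M n).2 < d) ∧
    ((traj R x M n).2 < d → ∀ m ≤ n,
      traj R x (M.restrict (Iic d ×ˢ univ)) m = traj R x M m) := by
  induction n with
  | zero =>
    refine ⟨Iff.rfl, fun _ m hm => ?_⟩
    rw [Nat.le_zero.1 hm]
    rfl
  | succ n ih =>
    have h1 : (traj R x M n).2 < d → (((traj R x (M.restrict (Iic d ×ˢ univ)) (n + 1)).2 < d ↔
        (traj R x M (n + 1)).2 < d)) := by
      intro h
      rw [traj, traj, ih.2 h n le_rfl]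
      exact nextTime_restrict_lt_iff hM hR _ le_rfl
    refine ⟨⟨fun h => ?_, fun h => ?_⟩, fun h m hm => ?_⟩
    · exact (h1 (ih.1.1 ((traj_time_mono x _ n.le_succ).trans_lt h))).1 h
    · exact (h1 ((traj_time_mono x _ n.le_succ).trans_lt h)).2 h
    · have h2 := (traj_time_mono x _ n.le_succ).trans_lt h
      rcases hm.lt_or_eq with hm | rfl
      · exact ih.2 h2 m (Nat.lt_succ_iff.1 hm)
      · rw [traj, traj, ih.2 h2 n le_rfl, nextTime_restrict hM hR h,
          nextState_restrict hM hR (traj_time_nonneg x M n) h]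

end Locality

end Trajectory

/-! ### Strong Markov property at the transition times. -/

lemma Avoids.mono {M : Measure (ℝ × ℝ)} {B B' : Set (ℝ × ℝ)} (h : Avoids M B) (hB : B' ⊆ B) :
    Avoids M B' := by
  intro n
  refine le_antisymm ?_ zero_le
  rw [← h n]
  gcongr

/-- Fubini: the independent variable `W` can be frozen, so the random set becomes deterministic. -/
lemma measure_avoids_of_indepFun {Ω S : Type*} [MeasurableSpace Ω] [MeasurableSpace S]
    {μ : Measure Ω} [IsProbabilityMeasure μ] {W : Ω → S} {N : Ω → Measure (ℝ × ℝ)}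
    (hW : Measurable W) (hN : Measurable N) (hind : IndepFun W N μ) {C : Set S}
    (hC : MeasurableSet C) {B : Set (S × (ℝ × ℝ))} (hB : MeasurableSet B) :
    μ {ω | W ω ∈ C ∧ Avoids (N ω) (Prod.mk (W ω) ⁻¹' B)} =
      ∫⁻ w in C, μ {ω | Avoids (N ω) (Prod.mk w ⁻¹' B)} ∂(μ.map W) := by
  have hD : MeasurableSet {w : S × Measure (ℝ × ℝ) | w.1 ∈ C ∧ Avoids w.2 (Prod.mk w.1 ⁻¹' B)} :=
    (hC.preimage measurable_fst).inter (measurableSet_avoids hB)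
  have h1 := (indepFun_iff_map_prod_eq_prod_map_map hW.aemeasurable hN.aemeasurable).1 hind
  have := Measure.isProbabilityMeasure_map (μ := μ) hN.aemeasurable
  have h2 : μ {ω | W ω ∈ C ∧ Avoids (N ω) (Prod.mk (W ω) ⁻¹' B)} =
      (μ.map fun ω => (W ω, N ω))
        {w : S × Measure (ℝ × ℝ) | w.1 ∈ C ∧ Avoids w.2 (Prod.mk w.1 ⁻¹' B)} := by
    rw [Measure.map_apply (hW.prodMk hN) hD]
    rfl
  rw [h2, h1, Measure.prod_apply hD, ← lintegral_indicator hC]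
  refine lintegral_congr fun w => ?_
  by_cases hw : w ∈ C
  · rw [indicator_of_mem hw, Measure.map_apply hN (hD.preimage measurable_prodMk_left)]
    simp [hw]
  · rw [indicator_of_notMem hw]
    convert measure_empty (μ := μ.map N)
    ext M
    simp [hw]

lemma volume_shift {Q : Set (ℝ × ℝ)} (t : ℝ) : volume (shift t Q) = volume Q := by
  have : shift t Q = (fun w => w + (-t, (0 : ℝ))) ⁻¹' Q := by
    ext w
    simp [shift, sub_eq_add_neg, Prod.add_def]
  rw [this, measure_preimage_add_right]

lemma measurableSet_avoids_shift {Ω : Type*} [MeasurableSpace Ω] {N : Ω → Measure (ℝ × ℝ)}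
    (hN : Measurable N) {τ : Ω → ℝ} (hτ : Measurable τ) {Q : Set (ℝ × ℝ)} (hQ : MeasurableSet Q) :
    MeasurableSet {ω | Avoids (N ω) (shift (τ ω) Q)} := by
  have h1 : Measurable fun y : ℝ × (ℝ × ℝ) => (y.2.1 - y.1, y.2.2) := by fun_prop
  have h2 : Measurable fun ω => (τ ω, N ω) := hτ.prodMk hN
  exact h2 (measurableSet_avoids (h1 hQ))

/-- The first `n + 1` states and transition times. -/
noncomputable def hist {k : ℕ} (R : Fin k → Fin k → Set (ℝ × ℝ)) (n : ℕ) (x : Fin k)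
    (M : Measure (ℝ × ℝ)) (m : Fin (n + 1)) : Fin k × ℝ :=
  ((traj R x M m).1, (traj R x M m).2.toReal)

lemma measurable_hist {k : ℕ} {R : Fin k → Fin k → Set (ℝ × ℝ)}
    (hR : ∀ i j, MeasurableSet (R i j)) (n : ℕ) :
    Measurable fun w : Fin k × Measure (ℝ × ℝ) => hist R n w.1 w.2 :=
  measurable_pi_lambda _ fun m =>
    (measurable_traj hR m).fst.prodMk (measurable_traj hR m).snd.ereal_toReal

section StrongMarkov

variable {Ω : Type*} [MeasurableSpace Ω] {μ : Measure Ω} [IsProbabilityMeasure μ]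
  {N : Ω → Measure (ℝ × ℝ)}

lemma IsPoissonRandomMeasure.ae_locFinite (hN : IsPoissonRandomMeasure μ N intensity) :
    ∀ᵐ ω ∂μ, LocFinite (N ω) := by
  refine ae_all_iff.2 fun n => hN.ae_ne_top (measurableSet_box n) ?_
  refine ne_top_of_le_ne_top ?_ (intensity_le_volume _)
  rw [box, Measure.volume_eq_prod, Measure.prod_prod, Real.volume_Icc]
  exact ENNReal.mul_ne_top ENNReal.ofReal_ne_top ENNReal.ofReal_ne_top

variable {k : ℕ} {R : Fin k → Fin k → Set (ℝ × ℝ)} {x : Ω → Fin k}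

lemma ereal_lt_of_toReal_lt {a : EReal} {d : ℝ} (ha : a ≠ ⊤) (h : a.toReal < d) : a < d := by
  refine (EReal.le_coe_toReal ha).trans_lt ?_
  exact_mod_cast h

/-- After translation by `t ≥ d - δ`, an age above `δ` means a time after `d`. So the part of `shift
t Q` after `d` has area between those of `Q ∩ Ioi δ ×ˢ univ` and `Q`. -/
lemma exp_volume_le_measure_avoids_shift (hN : IsPoissonRandomMeasure μ N intensity)
    {Q : Set (ℝ × ℝ)} (hQ : MeasurableSet Q) (hfin : volume Q ≠ ∞)
    {d δ t : ℝ} (hd : 0 ≤ d) (hδ : d - δ ≤ t) :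
    ENNReal.ofReal (Real.exp (-(volume Q).toReal)) ≤
      μ {ω | Avoids ((N ω).restrict (Iic d ×ˢ univ)ᶜ) (shift t Q)} ∧
    μ {ω | Avoids ((N ω).restrict (Iic d ×ˢ univ)ᶜ) (shift t Q)} ≤
      ENNReal.ofReal (Real.exp (-(volume (Q ∩ Ioi δ ×ˢ univ)).toReal)) := by
  set B := shift t Q ∩ (Iic d ×ˢ univ)ᶜ with hBdef
  have hB : MeasurableSet B :=
    (measurableSet_shift hQ t).inter (measurableSet_Iic.prod MeasurableSet.univ).compl
  have h1 : μ {ω | Avoids ((N ω).restrict (Iic d ×ˢ univ)ᶜ) (shift t Q)} = μ {ω | N ω B = 0} := by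
    refine measure_congr ?_
    filter_upwards [hN.ae_locFinite] with ω hω
    refine propext ?_
    change Avoids _ _ ↔ N ω B = 0
    rw [avoids_iff (hω.restrict _), Measure.restrict_apply (measurableSet_shift hQ t)]
  have h2 : intensity B = volume B := by
    rw [intensity, Measure.restrict_apply hB, inter_eq_left.2]
    intro w hw
    have : d < w.1 := by simpa using hw.2
    exact ⟨hd.trans_lt this, mem_univ _⟩
  have h3 : volume B ≤ volume Q := (measure_mono inter_subset_left).trans (volume_shift t).le
  have h4 : volume (Q ∩ Ioi δ ×ˢ univ) ≤ volume B := by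
    rw [← volume_shift t]
    refine measure_mono fun w hw => ⟨hw.1, ?_⟩
    have : δ < w.1 - t := hw.2.1
    simp only [mem_compl_iff, mem_prod, mem_Iic, mem_univ, and_true, not_le]
    linarith
  have h5 : volume B ≠ ∞ := ne_top_of_le_ne_top hfin h3
  rw [h1, hN.measure_eq_zero hB (by rwa [h2]), h2]
  constructor
  · gcongr
  · gcongr

variable (hN : IsPoissonRandomMeasure μ N intensity) (hx : Measurable x) (hind : IndepFun x N μ)
  (hR : ∀ i j, MeasurableSet (R i j))
include hN hx hind hR

/-- When the `n`-th transition falls in `[d - δ, d)`, the history depends on points up to `d` and is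
independent of the points after `d`. Ignoring the points between the transition and `d` costs at
most the ages up to `δ`, hence two one-sided bounds. -/
lemma measure_hist_avoids_slot (n : ℕ) (hT : ∀ᵐ ω ∂μ, (traj R (x ω) (N ω) n).2 ≠ ⊤)
    {d δ : ℝ} (hd : 0 ≤ d) {A : Set (Fin (n + 1) → Fin k × ℝ)} (hA : MeasurableSet A)
    (hAd : ∀ v ∈ A, d - δ ≤ (v (Fin.last n)).2 ∧ (v (Fin.last n)).2 < d) {Q : Set (ℝ × ℝ)}
    (hQ : MeasurableSet Q) (hfin : volume Q ≠ ∞) :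
    ENNReal.ofReal (Real.exp (-(volume Q).toReal)) * μ {ω | hist R n (x ω) (N ω) ∈ A} ≤
      μ {ω | hist R n (x ω) (N ω) ∈ A ∧
        Avoids (N ω) (shift (traj R (x ω) (N ω) n).2.toReal (Q ∩ Ioi δ ×ˢ univ))} ∧
    μ {ω | hist R n (x ω) (N ω) ∈ A ∧ Avoids (N ω) (shift (traj R (x ω) (N ω) n).2.toReal Q)} ≤
      ENNReal.ofReal (Real.exp (-(volume (Q ∩ Ioi δ ×ˢ univ)).toReal)) *
        μ {ω | hist R n (x ω) (N ω) ∈ A} := by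
  have hD : MeasurableSet (Iic d ×ˢ univ : Set (ℝ × ℝ)) := measurableSet_Iic.prod MeasurableSet.univ
  let W : Ω → Fin k × Measure (ℝ × ℝ) := fun ω => (x ω, (N ω).restrict (Iic d ×ˢ univ))
  have hm1 := (measurable_restrict hD).comp hN.measurable
  have hm2 := (measurable_restrict hD.compl).comp hN.measurable
  have hW : Measurable W := hx.prodMk hm1
  have hWind : IndepFun W (fun ω => (N ω).restrict (Iic d ×ˢ univ)ᶜ) μ :=
    indepFun_prodMk_left hx hm1 hm2
      (hind.comp measurable_id ((measurable_restrict hD).prodMk (measurable_restrict hD.compl)))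
      (hN.indepFun_restrict hD)
  -- The second condition is needed because `toReal` sends `⊤` to `0`: a truncated trajectory
  -- without an `n`-th transition could otherwise fall into `A`.
  let C : Set (Fin k × Measure (ℝ × ℝ)) :=
    {w | hist R n w.1 w.2 ∈ A} ∩ {w | (traj R w.1 w.2 n).2 ≠ ⊤}
  have hC : MeasurableSet C := (hA.preimage (measurable_hist hR n)).inter
    ((measurableSet_singleton _).preimage (measurable_traj hR n).snd).compl
  have hWC : ∀ᵐ ω ∂μ, (W ω ∈ C ↔ hist R n (x ω) (N ω) ∈ A) ∧
      (W ω ∈ C → traj R (W ω).1 (W ω).2 n = traj R (x ω) (N ω) n) := by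
    filter_upwards [hT, hN.ae_locFinite] with ω hω hloc
    have h1 := traj_restrict (d := d) hloc hR (x ω) n
    have h2 : (traj R (x ω) (N ω) n).2 < d →
        hist R n (W ω).1 (W ω).2 = hist R n (x ω) (N ω) := by
      intro h
      ext m : 1
      simp only [hist, W, h1.2 h m (Nat.lt_succ_iff.1 m.2)]
    have h3 : W ω ∈ C → (traj R (x ω) (N ω) n).2 < d := fun h =>
      h1.1.1 (ereal_lt_of_toReal_lt h.2 (hAd _ h.1).2)
    refine ⟨⟨fun h => ?_, fun h => ?_⟩, fun h => h1.2 (h3 h) n le_rfl⟩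
    · rw [← h2 (h3 h)]
      exact h.1
    · have h4 : (traj R (x ω) (N ω) n).2 < d := ereal_lt_of_toReal_lt hω (hAd _ h).2
      refine ⟨?_, ?_⟩
      · rw [mem_ofPred_eq, h2 h4]
        exact h
      · rw [mem_ofPred_eq]
        simp only [W]
        rw [h1.2 h4 n le_rfl]
        exact hω
  let B : Set ((Fin k × Measure (ℝ × ℝ)) × (ℝ × ℝ)) :=
    {y | (y.2.1 - (traj R y.1.1 y.1.2 n).2.toReal, y.2.2) ∈ Q}
  have hB : MeasurableSet B := by
    have h1 := (measurable_traj hR n).snd.ereal_toReal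
    exact hQ.preimage (((measurable_snd.fst).sub (h1.comp measurable_fst)).prodMk
      measurable_snd.snd)
  have hBs : ∀ w, Prod.mk w ⁻¹' B = shift (traj R w.1 w.2 n).2.toReal Q := fun w => rfl
  have key := measure_avoids_of_indepFun hW hm2 hWind hC hB
  simp_rw [hBs] at key
  have hμ : μ {ω | hist R n (x ω) (N ω) ∈ A} = μ.map W C := by
    rw [Measure.map_apply hW hC]
    refine measure_congr ?_
    filter_upwards [hWC] with ω hω
    exact propext hω.1.symm
  have hbd : ∀ w ∈ C, d - δ ≤ (traj R w.1 w.2 n).2.toReal := fun w hw => (hAd _ hw.1).1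
  have hcomp : ∀ᵐ ω ∂μ, ∀ Q' : Set (ℝ × ℝ), MeasurableSet Q' → ∀ t : ℝ,
      (Avoids ((N ω).restrict (Iic d ×ˢ univ)ᶜ) (shift t Q') ↔
        N ω (shift t Q' ∩ (Iic d ×ˢ univ)ᶜ) = 0) := by
    filter_upwards [hN.ae_locFinite] with ω hω Q' hQ' t
    rw [avoids_iff (hω.restrict _), Measure.restrict_apply (measurableSet_shift hQ' t)]
  rw [hμ, ← setLIntegral_const, ← setLIntegral_const]
  constructor
  · calc _ ≤ _ := setLIntegral_mono' hC fun w hw =>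
          (exp_volume_le_measure_avoids_shift hN hQ hfin hd (hbd w hw)).1
      _ = _ := key.symm
      _ ≤ _ := by
        refine measure_mono_ae ?_
        filter_upwards [hWC, hN.ae_locFinite, hcomp] with ω hω hloc hc
        intro h
        obtain ⟨h1, h2⟩ := h
        refine ⟨hω.1.1 h1, ?_⟩
        change Avoids ((N ω).restrict (Iic d ×ˢ univ)ᶜ) _ at h2
        rw [hc Q hQ, hω.2 h1] at h2
        rw [avoids_iff hloc]
        refine measure_mono_null ?_ h2
        intro w hw
        refine ⟨hw.1, ?_⟩
        have h3 := hbd _ h1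
        rw [hω.2 h1] at h3
        have h4 : δ < w.1 - (traj R (x ω) (N ω) n).2.toReal := hw.2.1
        simp only [mem_compl_iff, mem_prod, mem_Iic, mem_univ, and_true, not_le]
        linarith
  · calc _ ≤ _ := by
          refine measure_mono_ae ?_
          filter_upwards [hWC, hN.ae_locFinite, hcomp] with ω hω hloc hc
          intro h
          obtain ⟨h1, h2⟩ := h
          refine ⟨hω.1.2 h1, ?_⟩
          change Avoids ((N ω).restrict (Iic d ×ˢ univ)ᶜ) _
          rw [hc Q hQ, hω.2 (hω.1.2 h1)]
          rw [avoids_iff hloc] at h2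
          exact measure_mono_null inter_subset_left h2
      _ = _ := key
      _ ≤ _ := setLIntegral_mono' hC fun w hw =>
          (exp_volume_le_measure_avoids_shift hN hQ hfin hd (hbd w hw)).2

lemma measure_hist_avoids_bounds (n : ℕ) (hT : ∀ᵐ ω ∂μ, (traj R (x ω) (N ω) n).2 ≠ ⊤)
    {δ : ℝ} (hδ : 0 < δ) {A : Set (Fin (n + 1) → Fin k × ℝ)} (hA : MeasurableSet A)
    {Q : Set (ℝ × ℝ)} (hQ : MeasurableSet Q) (hfin : volume Q ≠ ∞) :
    ENNReal.ofReal (Real.exp (-(volume Q).toReal)) * μ {ω | hist R n (x ω) (N ω) ∈ A} ≤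
      μ {ω | hist R n (x ω) (N ω) ∈ A ∧
        Avoids (N ω) (shift (traj R (x ω) (N ω) n).2.toReal (Q ∩ Ioi δ ×ˢ univ))} ∧
    μ {ω | hist R n (x ω) (N ω) ∈ A ∧ Avoids (N ω) (shift (traj R (x ω) (N ω) n).2.toReal Q)} ≤
      ENNReal.ofReal (Real.exp (-(volume (Q ∩ Ioi δ ×ˢ univ)).toReal)) *
        μ {ω | hist R n (x ω) (N ω) ∈ A} := by
  -- On `L l` the last transition time lies in `[l δ, (l + 1) δ)`, so the slot bound applies with `d
  -- = (l + 1) δ`.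
  let L : ℕ → Set (Fin (n + 1) → Fin k × ℝ) := fun l =>
    A ∩ {v | ⌊(v (Fin.last n)).2 / δ⌋₊ = l ∧ 0 ≤ (v (Fin.last n)).2}
  have hL : ∀ l, MeasurableSet (L l) := by
    intro l
    have hm : Measurable fun v : Fin (n + 1) → Fin k × ℝ => (v (Fin.last n)).2 := by fun_prop
    refine hA.inter (MeasurableSet.inter ?_ (measurableSet_le measurable_const hm))
    exact (measurableSet_singleton l).preimage (Nat.measurable_floor.comp (hm.div_const δ))
  have hLd : ∀ l, ∀ v ∈ L l, ((l + 1 : ℕ) * δ : ℝ) - δ ≤ (v (Fin.last n)).2 ∧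
      (v (Fin.last n)).2 < ((l + 1 : ℕ) * δ : ℝ) := by
    intro l v hv
    have h0 := hv.2.2
    have h1 := (Nat.floor_eq_iff (div_nonneg h0 hδ.le)).1 hv.2.1
    rw [le_div_iff₀ hδ, div_lt_iff₀ hδ] at h1
    push_cast
    exact ⟨by linarith [h1.1], h1.2⟩
  have hslot := fun l => measure_hist_avoids_slot hN hx hind hR n hT
    (show (0 : ℝ) ≤ ((l + 1 : ℕ) * δ : ℝ) by positivity) (hL l) (hLd l) hQ hfin
  have hH : Measurable fun ω => hist R n (x ω) (N ω) :=
    (measurable_hist hR n).comp (hx.prodMk hN.measurable)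
  have hsum : ∀ D : Set Ω, MeasurableSet D →
      μ {ω | hist R n (x ω) (N ω) ∈ A ∧ ω ∈ D} =
        ∑' l, μ {ω | hist R n (x ω) (N ω) ∈ L l ∧ ω ∈ D} := by
    intro D hD
    rw [← measure_iUnion]
    · congr 1
      ext ω
      simp only [mem_ofPred_eq, L, mem_inter_iff, mem_iUnion]
      have : 0 ≤ (hist R n (x ω) (N ω) (Fin.last n)).2 :=
        EReal.toReal_nonneg (traj_time_nonneg _ _ _)
      tauto
    · intro l l' hll'
      exact disjoint_left.2 fun ω h1 h2 => hll' (h1.1.2.1.symm.trans h2.1.2.1)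
    · exact fun l => ((hL l).preimage hH).inter hD
  have hτ : Measurable fun ω => (traj R (x ω) (N ω) n).2.toReal :=
    (measurable_traj hR n).snd.ereal_toReal.comp (hx.prodMk hN.measurable)
  have h0 := hsum univ MeasurableSet.univ
  simp only [mem_univ, and_true] at h0
  have h1 := hsum _ (measurableSet_avoids_shift hN.measurable hτ hQ)
  have h2 := hsum _ (measurableSet_avoids_shift hN.measurable hτ
    (hQ.inter (measurableSet_Ioi.prod MeasurableSet.univ) : MeasurableSet (Q ∩ Ioi δ ×ˢ univ)))
  simp only [mem_ofPred_eq] at h1 h2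
  rw [h0, h1, h2, ← ENNReal.tsum_mul_left, ← ENNReal.tsum_mul_left]
  exact ⟨ENNReal.tsum_le_tsum fun l => (hslot l).1, ENNReal.tsum_le_tsum fun l => (hslot l).2⟩

/-- The strong Markov property at the `n`-th transition time, for void probabilities. -/
lemma measure_hist_avoids (n : ℕ) (hT : ∀ᵐ ω ∂μ, (traj R (x ω) (N ω) n).2 ≠ ⊤)
    {A : Set (Fin (n + 1) → Fin k × ℝ)} (hA : MeasurableSet A)
    {Q : Set (ℝ × ℝ)} (hQ : MeasurableSet Q) (hQ0 : Q ⊆ Ioi 0 ×ˢ univ) (hfin : volume Q ≠ ∞) :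
    μ {ω | hist R n (x ω) (N ω) ∈ A ∧ Avoids (N ω) (shift (traj R (x ω) (N ω) n).2.toReal Q)} =
      ENNReal.ofReal (Real.exp (-(volume Q).toReal)) * μ {ω | hist R n (x ω) (N ω) ∈ A} := by
  -- With `δ = 1 / (m + 1)` tending to `0`, the sets `Q' m` increase to `Q` since `Q` has positive
  -- ages only. The upper bound passes to the limit by continuity of the area, the lower one by
  -- continuity of `μ` along the decreasing events `G m`.
  let Q' : ℕ → Set (ℝ × ℝ) := fun m => Q ∩ Ioi (1 / ((m : ℝ) + 1)) ×ˢ univ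
  have hQ' : ∀ m, MeasurableSet (Q' m) := fun m =>
    hQ.inter (measurableSet_Ioi.prod MeasurableSet.univ)
  have hτ : Measurable fun ω => (traj R (x ω) (N ω) n).2.toReal :=
    (measurable_traj hR n).snd.ereal_toReal.comp (hx.prodMk hN.measurable)
  have hmono : Monotone Q' := by
    intro a b hab
    refine inter_subset_inter_right _ (prod_mono (Ioi_subset_Ioi ?_) subset_rfl)
    exact one_div_le_one_div_of_le (by positivity) (by gcongr)
  have hU : ⋃ m, Q' m = Q := by
    ext w
    simp only [Q', mem_iUnion, mem_inter_iff, exists_and_left, and_iff_left_iff_imp]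
    intro hw
    obtain ⟨m, hm⟩ := exists_nat_one_div_lt (show 0 < w.1 from (hQ0 hw).1)
    exact ⟨m, hm, mem_univ _⟩
  have hb := fun m : ℕ => measure_hist_avoids_bounds hN hx hind hR n hT
    (Nat.one_div_pos_of_nat (α := ℝ) (n := m)) hA hQ hfin
  apply le_antisymm
  · have ht : Tendsto (fun m => ENNReal.ofReal (Real.exp (-(volume (Q' m)).toReal)) *
        μ {ω | hist R n (x ω) (N ω) ∈ A}) atTop (𝓝 (ENNReal.ofReal
          (Real.exp (-(volume Q).toReal)) * μ {ω | hist R n (x ω) (N ω) ∈ A})) := by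
      refine ENNReal.Tendsto.mul_const ?_ (Or.inr (measure_ne_top _ _))
      refine ENNReal.tendsto_ofReal ((Real.continuous_exp.tendsto _).comp (Tendsto.neg ?_))
      refine (ENNReal.tendsto_toReal hfin).comp ?_
      have := tendsto_measure_iUnion_atTop (μ := volume) hmono
      rwa [hU] at this
    exact ge_of_tendsto' ht fun m => (hb m).2
  · let G : ℕ → Set Ω := fun m => {ω | hist R n (x ω) (N ω) ∈ A ∧
      Avoids (N ω) (shift (traj R (x ω) (N ω) n).2.toReal (Q' m))}
    have hG : ∀ m, MeasurableSet (G m) := by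
      intro m
      exact (hA.preimage ((measurable_hist hR n).comp (hx.prodMk hN.measurable))).inter
        (measurableSet_avoids_shift hN.measurable hτ (hQ' m))
    have hanti : Antitone G := fun a b hab ω hω =>
      ⟨hω.1, hω.2.mono fun w hw => hmono hab hw⟩
    have ht := tendsto_measure_iInter_atTop (μ := μ) (fun m => (hG m).nullMeasurableSet) hanti
      ⟨0, measure_ne_top _ _⟩
    refine (ge_of_tendsto' ht fun m => (hb m).1).trans (measure_mono_ae ?_)
    filter_upwards [hN.ae_locFinite] with ω hω
    intro h
    have h' : ω ∈ ⋂ m, G m := h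
    rw [mem_iInter] at h'
    refine ⟨(h' 0).1, ?_⟩
    rw [avoids_iff hω, ← hU]
    have : shift (traj R (x ω) (N ω) n).2.toReal (⋃ m, Q' m) =
        ⋃ m, shift (traj R (x ω) (N ω) n).2.toReal (Q' m) := by
      ext w
      simp [shift]
    rw [this, measure_iUnion_null_iff]
    exact fun m => (avoids_iff hω).1 (h' m).2

end StrongMarkov

/-! ### Jump coefficients and integrals up to a time. -/

section JumpCoefficients

variable {k : ℕ} {p : Matrix (Fin k) (Fin k) ℝ} {F f : Fin k → ℝ → ℝ} {c : ℝ}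

lemma e_injective : Function.Injective (e : Fin k → Fin k → ℝ) := by
  intro i j hij
  by_contra hne
  have := congrFun hij i
  simp [e, hne] at this

lemma h_apply_eq_one {i j : Fin k} {y z : ℝ} (hj : j ≠ i) (hz : z ∈ Lam p F f c i j y) :
    h p F f c i y z j = 1 := by
  rw [h, Finset.sum_apply, Finset.sum_eq_single j]
  · rw [if_pos ⟨hj, hz⟩]
    simp [e, hj]
  · intro b _ hb
    split_ifs
    · simp [e, hb.symm, hj]
    · rfl
  · simp

/-- Jumps are bounded away from zero, so integrability of `h` makes the mass of effective points
finite on bounded time intervals. -/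
lemma one_le_norm_h {i : Fin k} {y z : ℝ} (hne : h p F f c i y z ≠ 0) :
    1 ≤ ‖h p F f c i y z‖ := by
  classical
  obtain ⟨j, -, hj⟩ := Finset.exists_ne_zero_of_sum_ne_zero hne
  have hj' : j ≠ i ∧ z ∈ Lam p F f c i j y := by
    by_contra hcon
    exact hj (if_neg hcon)
  have h1 := h_apply_eq_one hj'.1 hj'.2
  calc (1 : ℝ) = ‖h p F f c i y z j‖ := by rw [h1, norm_one]
    _ ≤ _ := norm_le_pi_norm _ j

lemma h_eq_zero {i : Fin k} {y z : ℝ} (hz : ∀ j, j ≠ i → z ∉ Lam p F f c i j y) :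
    h p F f c i y z = 0 :=
  Finset.sum_eq_zero fun j _ => if_neg fun hj => hz j hj.1 hj.2

lemma g_eq_zero {i : Fin k} {y z : ℝ} (hz : ∀ j, j ≠ i → z ∉ Lam p F f c i j y) :
    g p F f c i y z = 0 :=
  if_neg fun ⟨j, hj⟩ => hz j hj.1 hj.2

lemma g_eq {i j : Fin k} {y z : ℝ} (hj : j ≠ i) (hz : z ∈ Lam p F f c i j y) :
    g p F f c i y z = y :=
  if_pos ⟨j, hj, hz⟩

lemma g_eq_zero_of_h_eq_zero {i : Fin k} {y z : ℝ}
    (h0 : h p F f c i y z = 0) : g p F f c i y z = 0 := by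
  classical
  refine g_eq_zero fun j hj hz => ?_
  have h1 := h_apply_eq_one hj hz
  rw [h0] at h1
  exact zero_ne_one h1

lemma h_eq (hp : p ∈ Matrix.rowStochastic ℝ (Fin k)) (hp0 : ∀ i, p i i = 0)
    (hF : ∀ i, IsHoldingTimeDistribution (F i) (f i)) {i j : Fin k} {y z : ℝ} (hy : 0 ≤ y)
    (hj : j ≠ i) (hz : z ∈ Lam p F f c i j y) : h p F f c i y z = e j - e i := by
  rw [h, Finset.sum_eq_single j]
  · rw [if_pos ⟨hj, hz⟩]
  · intro b _ hb
    rw [if_neg]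
    exact fun hb' => hb (Lam_inj hp hp0 hF hy hb'.2 hz)
  · simp

end JumpCoefficients

section TimeIntegrals

variable {V : Type*} [NormedAddCommGroup V] [NormedSpace ℝ V] {M : Measure (ℝ × ℝ)}
  {φ : ℝ × ℝ → V} (hφ : ∀ t, 0 ≤ t → IntegrableOn φ (Ioc 0 t ×ˢ univ) M)
include hφ

lemma setIntegral_Ioc_add {s t : ℝ} (hs : 0 ≤ s) (hst : s ≤ t) :
    ∫ q in Ioc 0 t ×ˢ univ, φ q ∂M =
      ∫ q in Ioc 0 s ×ˢ univ, φ q ∂M + ∫ q in Ioc s t ×ˢ univ, φ q ∂M := by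
  rw [← setIntegral_union _ (measurableSet_Ioc.prod MeasurableSet.univ) (hφ s hs)
    ((hφ t (hs.trans hst)).mono_set (prod_mono (Ioc_subset_Ioc_left hs) subset_rfl)),
    ← union_prod, Ioc_union_Ioc_eq_Ioc hs hst]
  exact Set.Disjoint.set_prod_left (Ioc_disjoint_Ioc_of_le le_rfl) _ _

/-- The integral over `(0, r)` is the left limit of the integrals; what remains is the contribution
of the points at time `r` itself. -/
lemma setIntegral_Ioc_eq_of_tendsto {r : ℝ} (hr : 0 < r) {L : V}
    (hL : Tendsto (fun s => ∫ q in Ioc 0 s ×ˢ univ, φ q ∂M) (𝓝[<] r) (𝓝 L)) :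
    ∫ q in Ioc 0 r ×ˢ univ, φ q ∂M = L + ∫ q in {r} ×ˢ univ, φ q ∂M := by
  have hIoo : IntegrableOn φ (Ioo 0 r ×ˢ univ) M :=
    (hφ r hr.le).mono_set (prod_mono Ioo_subset_Ioc_self subset_rfl)
  have h1 : ∫ q in Ioo 0 r ×ˢ univ, φ q ∂M = L := by
    obtain ⟨u, hu, hu', hlim⟩ := exists_seq_strictMono_tendsto' hr
    have hU : ⋃ n, Ioc 0 (u n) ×ˢ (univ : Set ℝ) = Ioo 0 r ×ˢ univ := by
      ext q
      simp only [mem_iUnion, mem_prod, mem_Ioc, mem_univ, and_true, mem_Ioo]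
      refine ⟨fun ⟨n, hn⟩ => ⟨hn.1, hn.2.trans_lt (hu' n).2⟩, fun hq => ?_⟩
      obtain ⟨n, hn⟩ := (hlim.eventually (lt_mem_nhds hq.2)).exists
      exact ⟨n, hq.1, hn.le⟩
    have h2 := tendsto_setIntegral_of_monotone (μ := M) (f := φ)
      (s := fun n => Ioc 0 (u n) ×ˢ (univ : Set ℝ))
      (fun n => measurableSet_Ioc.prod MeasurableSet.univ)
      (fun a b hab => prod_mono (Ioc_subset_Ioc_right (hu.monotone hab)) subset_rfl)
      (by rwa [hU])
    rw [hU] at h2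
    refine tendsto_nhds_unique h2 (hL.comp (tendsto_nhdsWithin_iff.2 ⟨hlim, ?_⟩))
    exact Eventually.of_forall fun n => (hu' n).2
  rw [← h1, ← setIntegral_union _ ((measurableSet_singleton r).prod MeasurableSet.univ) hIoo
    ((hφ r hr.le).mono_set (prod_mono (singleton_subset_iff.2 ⟨hr, le_rfl⟩) subset_rfl)),
    ← union_prod, Ioo_union_right hr]
  exact Set.Disjoint.set_prod_left (by simp) _ _

end TimeIntegrals

/-! ### Pathwise identification of a solution with the trajectory. -/

lemma measure_window_eq_zero {k : ℕ} {R : Fin k → Fin k → Set (ℝ × ℝ)} {M : Measure (ℝ × ℝ)}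
    (hM : LocFinite M) {i : Fin k} {t r : ℝ} (hr : (r : EReal) < nextTime R (i, (t : EReal)) M) :
    M (window (⋃ j, R i j) t r) = 0 := by
  by_contra hne
  obtain ⟨v, hv1, hv2⟩ := EReal.lt_iff_exists_rat_btwn.1 hr
  have htr : t < r := by
    by_contra hcon
    refine hne ?_
    rw [window, Ioc_eq_empty hcon]
    simp
  refine lt_asymm hv2 ?_
  -- The real `r` need not be rational; a rational `q` slightly above it has a larger, still charged
  -- window and precedes the infimum, a contradiction.
  obtain ⟨q, hq1, hq2⟩ := exists_rat_btwn (EReal.coe_lt_coe_iff.1 hv1)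
  refine nextTime_lt_iff.2 ⟨q, ?_, ?_, ?_⟩
  · exact EReal.coe_lt_coe_iff.2 (htr.trans hq1)
  · exact EReal.coe_lt_coe_iff.2 hq2
  · rw [avoids_iff hM]
    exact fun h => hne (measure_mono_null (window_mono_right _ t hq1.le) h)

/-- A solution `(x, y)` of the integral equations driven by the point configuration `M`. -/
structure PathSolution {k : ℕ} (p : Matrix (Fin k) (Fin k) ℝ) (F f : Fin k → ℝ → ℝ) (c : ℝ)
    (M : Measure (ℝ × ℝ)) (x : ℝ → Fin k) (y : ℝ → ℝ) : Prop where
  locFinite : LocFinite M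
  integerValued : ∀ B : Set (ℝ × ℝ), MeasurableSet B → ∃ n : ℕ∞, M B = (n : ℝ≥0∞)
  slice : ∀ u : ℝ, M ({u} ×ˢ univ) = 0 ∨ ∃ z, M.restrict ({u} ×ˢ univ) = Measure.dirac (u, z)
  leftLimits : ∀ u, 0 < u → (∃ i, Tendsto x (𝓝[<] u) (𝓝 i)) ∧ (∃ v, Tendsto y (𝓝[<] u) (𝓝 v))
  integrable_h : ∀ t, 0 ≤ t → IntegrableOn (fun q : ℝ × ℝ => h p F f c (Function.leftLim x q.1)
    (Function.leftLim y q.1) q.2) (Ioc 0 t ×ˢ univ) M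
  integrable_g : ∀ t, 0 ≤ t → IntegrableOn (fun q : ℝ × ℝ => g p F f c (Function.leftLim x q.1)
    (Function.leftLim y q.1) q.2) (Ioc 0 t ×ˢ univ) M
  eq_x : ∀ t, 0 ≤ t → e (x t) = e (x 0) + ∫ q in Ioc 0 t ×ˢ univ,
    h p F f c (Function.leftLim x q.1) (Function.leftLim y q.1) q.2 ∂M
  eq_y : ∀ t, 0 ≤ t → y t = t - ∫ q in Ioc 0 t ×ˢ univ,
    g p F f c (Function.leftLim x q.1) (Function.leftLim y q.1) q.2 ∂M

namespace PathSolution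

variable {k : ℕ} {p : Matrix (Fin k) (Fin k) ℝ} {F f : Fin k → ℝ → ℝ} {c : ℝ}
  {M : Measure (ℝ × ℝ)} {x : ℝ → Fin k} {y : ℝ → ℝ}

lemma leftLim_eq {α : Type*} [TopologicalSpace α] [T2Space α] {x : ℝ → α} {r : ℝ} {a : α}
    (h : Tendsto x (𝓝[<] r) (𝓝 a)) : Function.leftLim x r = a :=
  leftLim_eq_of_tendsto h

lemma jump (S : PathSolution p F f c M x y) {r : ℝ} (hr : 0 < r) :
    e (x r) = e (Function.leftLim x r) + ∫ q in {r} ×ˢ univ,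
      h p F f c (Function.leftLim x q.1) (Function.leftLim y q.1) q.2 ∂M ∧
    y r = Function.leftLim y r - ∫ q in {r} ×ˢ univ,
      g p F f c (Function.leftLim x q.1) (Function.leftLim y q.1) q.2 ∂M := by
  obtain ⟨⟨i, hi⟩, ⟨v, hv⟩⟩ := S.leftLimits r hr
  have hev : ∀ᶠ s in 𝓝[<] r, 0 ≤ s := by
    filter_upwards [Ioo_mem_nhdsLT hr] with s hs using hs.1.le
  rw [leftLim_eq hi, leftLim_eq hv]
  constructor
  · have h1 : Tendsto (fun s => e (x s)) (𝓝[<] r) (𝓝 (e i)) :=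
      ((continuous_of_discreteTopology (f := (e : Fin k → Fin k → ℝ))).tendsto i).comp hi
    have h2 := setIntegral_Ioc_eq_of_tendsto S.integrable_h hr (L := e i - e (x 0)) <| by
      refine (h1.sub_const (e (x 0))).congr' ?_
      filter_upwards [hev] with s hs
      rw [S.eq_x s hs, add_sub_cancel_left]
    rw [S.eq_x r hr.le, h2]
    abel
  · have h2 := setIntegral_Ioc_eq_of_tendsto S.integrable_g hr (L := r - v) <| by
      have : Tendsto (fun s : ℝ => s - y s) (𝓝[<] r) (𝓝 (r - v)) :=
        (tendsto_id.mono_left nhdsWithin_le_nhds).sub hv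
      refine this.congr' ?_
      filter_upwards [hev] with s hs
      rw [S.eq_y s hs, sub_sub_cancel]
    rw [S.eq_y r hr.le, h2]
    abel

/-- After every time there is a period without effective points. -/
lemma exists_quiet (S : PathSolution p F f c M x y) {t : ℝ} (ht : 0 ≤ t) :
    ∃ r, t < r ∧ M {q | q.1 ∈ Ioc t r ∧ h p F f c (Function.leftLim x q.1)
      (Function.leftLim y q.1) q.2 ≠ 0} = 0 ∧
      ∀ s ∈ Icc t r, x s = x t ∧ y s = y t + (s - t) := by
  set φ : ℝ × ℝ → Fin k → ℝ := fun q => h p F f c (Function.leftLim x q.1)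
    (Function.leftLim y q.1) q.2 with hφ
  have hint : Integrable φ (M.restrict (Ioc 0 (t + 1) ×ˢ univ)) :=
    S.integrable_h (t + 1) (by linarith)
  set M' := M.restrict (Ioc 0 (t + 1) ×ˢ univ) with hM'
  have hE : NullMeasurableSet {q | φ q ≠ 0} M' :=
    hint.aestronglyMeasurable.aemeasurable.nullMeasurableSet_preimage
      (measurableSet_singleton (0 : Fin k → ℝ)).compl
  -- Markov's inequality, as `1 ≤ ‖φ q‖` wherever `φ q ≠ 0`.
  have hEfin : M' {q | φ q ≠ 0} < ∞ :=
    (measure_mono fun q hq => one_le_norm_h hq).trans_lt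
      (hint.measure_norm_ge_lt_top one_pos)
  let A : ℕ → Set (ℝ × ℝ) := fun n => {q | q.1 ∈ Ioc t (t + 1 / ((n : ℝ) + 1)) ∧ φ q ≠ 0}
  have hA : ∀ n, NullMeasurableSet (A n) M' := fun n =>
    ((measurableSet_Ioc.preimage measurable_fst).nullMeasurableSet).inter hE
  have hanti : Antitone A := by
    intro a b hab q hq
    refine ⟨⟨hq.1.1, hq.1.2.trans ?_⟩, hq.2⟩
    gcongr
  have hempty : ⋂ n, A n = ∅ := by
    refine eq_empty_of_forall_notMem fun q hq => ?_
    rw [mem_iInter] at hq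
    obtain ⟨n, hn⟩ := exists_nat_one_div_lt (sub_pos.2 (hq 0).1.1)
    have := (hq n).1.2
    linarith
  have hlim := tendsto_measure_iInter_atTop hA hanti
    ⟨0, ((measure_mono fun q hq => hq.2).trans_lt hEfin).ne⟩
  rw [hempty, measure_empty] at hlim
  obtain ⟨n, hn⟩ := (hlim.eventually (gt_mem_nhds one_pos)).exists
  rw [Function.comp_apply] at hn
  -- A mass below `1` of an integer-valued measure is `0`. The set `A n` is only known to be null
  -- measurable, so the argument runs through its measurable hull.
  have hn0 : M' (A n) = 0 := by
    obtain ⟨m, hm⟩ := S.integerValued (toMeasurable M' (A n) ∩ Ioc 0 (t + 1) ×ˢ univ)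
      ((measurableSet_toMeasurable _ _).inter (measurableSet_Ioc.prod MeasurableSet.univ))
    rw [← Measure.restrict_apply (measurableSet_toMeasurable _ _), ← hM',
      measure_toMeasurable] at hm
    rw [hm] at hn ⊢
    have h1 : m < 1 := by exact_mod_cast hn
    rw [Order.lt_one_iff.1 h1, ENat.toENNReal_zero]
  set r := t + 1 / ((n : ℝ) + 1) with hr
  have htr : t < r := by
    rw [hr]
    linarith [Nat.one_div_pos_of_nat (α := ℝ) (n := n)]
  have hr1 : r ≤ t + 1 := by
    rw [hr]
    gcongr
    rw [div_le_one (by positivity)]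
    linarith [(Nat.cast_nonneg n : (0 : ℝ) ≤ n)]
  have hnull : M (A n) = 0 := by
    rwa [hM', Measure.restrict_eq_self] at hn0
    exact fun q hq => ⟨⟨ht.trans_lt hq.1.1, hq.1.2.trans hr1⟩, mem_univ _⟩
  refine ⟨r, htr, hnull, fun s hs => ?_⟩
  have hs0 : 0 ≤ s := ht.trans hs.1
  have hzero : ∀ᵐ q ∂M.restrict (Ioc t s ×ˢ univ), φ q = 0 := by
    rw [ae_restrict_iff' (measurableSet_Ioc.prod MeasurableSet.univ), ae_iff]
    refine measure_mono_null (fun q hq => ?_) hnull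
    rw [mem_ofPred_eq, Classical.not_imp] at hq
    exact ⟨⟨hq.1.1.1, hq.1.1.2.trans hs.2⟩, hq.2⟩
  constructor
  · apply e_injective
    rw [S.eq_x s hs0, setIntegral_Ioc_add S.integrable_h ht hs.1, ← add_assoc, ← S.eq_x t ht,
      integral_eq_zero_of_ae (μ := M.restrict (Ioc t s ×ˢ univ)) hzero, add_zero]
  · have hzero' : ∀ᵐ q ∂M.restrict (Ioc t s ×ˢ univ), g p F f c (Function.leftLim x q.1)
        (Function.leftLim y q.1) q.2 = 0 := by
      filter_upwards [hzero] with q hq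
      exact g_eq_zero_of_h_eq_zero hq
    rw [S.eq_y s hs0, setIntegral_Ioc_add S.integrable_g ht hs.1,
      integral_eq_zero_of_ae (μ := M.restrict (Ioc t s ×ˢ univ)) hzero', S.eq_y t ht]
    ring

section Step

variable (S : PathSolution p F f c M x y) (hp : p ∈ Matrix.rowStochastic ℝ (Fin k))
  (hp0 : ∀ i, p i i = 0) (hF : ∀ i, IsHoldingTimeDistribution (F i) (f i))
  {t : ℝ} (ht : 0 ≤ t) {i : Fin k}

lemma leftLim_of_growth {r : ℝ} (htr : t < r) (hP : ∀ u ∈ Ico t r, x u = i ∧ y u = u - t) :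
    Function.leftLim x r = i ∧ Function.leftLim y r = r - t := by
  have hev : ∀ᶠ s in 𝓝[<] r, s ∈ Ico t r := Ico_mem_nhdsLT htr
  constructor
  · refine leftLim_eq (tendsto_const_nhds.congr' ?_)
    filter_upwards [hev] with s hs using (hP s hs).1.symm
  · have h1 : Tendsto (fun s => s - t) (𝓝[<] r) (𝓝 (r - t)) :=
      (tendsto_id.mono_left nhdsWithin_le_nhds).sub_const t
    refine leftLim_eq (h1.congr' ?_)
    filter_upwards [hev] with s hs using (hP s hs).2.symm

include S hp hp0 hF ht

/-- At time `r` there is at most one point, and the left limits there are `i` and `r - t`. So a jump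
is decided by whether its mark lies in some `Λ_ij(r - t)`. -/
lemma jump_or_not {r : ℝ} (htr : t < r) (hP : ∀ u ∈ Ico t r, x u = i ∧ y u = u - t) :
    (x r = i ∧ y r = r - t ∧ M (shift t (⋃ j, region p F f c i j) ∩ {r} ×ˢ univ) = 0) ∨
    ∃ j, j ≠ i ∧ x r = j ∧ y r = 0 ∧
      ∀ j', M (shift t (region p F f c i j') ∩ {r} ×ˢ univ) = 0 ↔ j' ≠ j := by
  obtain ⟨hl1, hl2⟩ := leftLim_of_growth htr hP
  obtain ⟨hj1, hj2⟩ := S.jump (ht.trans_lt htr)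
  have hms : MeasurableSet ({r} ×ˢ univ : Set (ℝ × ℝ)) :=
    (measurableSet_singleton r).prod MeasurableSet.univ
  rcases S.slice r with h0 | ⟨z, hz⟩
  · left
    rw [Measure.restrict_eq_zero.2 h0, integral_zero_measure] at hj1 hj2
    rw [add_zero, hl1] at hj1
    rw [sub_zero, hl2] at hj2
    exact ⟨e_injective hj1, hj2, measure_mono_null inter_subset_right h0⟩
  · rw [hz, integral_dirac] at hj1 hj2
    simp only [hl1, hl2] at hj1 hj2
    have hreg : ∀ j, MeasurableSet (shift t (region p F f c i j)) := fun j =>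
      measurableSet_shift (measurableSet_region hF i j) t
    have hM : ∀ j, M (shift t (region p F f c i j) ∩ {r} ×ˢ univ) = 0 ↔
        z ∉ Lam p F f c i j (r - t) := by
      intro j
      rw [← Measure.restrict_apply (hreg j), hz, Measure.dirac_apply' _ (hreg j),
        indicator_apply_eq_zero]
      simp [shift, region, htr]
    by_cases hex : ∃ j, z ∈ Lam p F f c i j (r - t)
    · obtain ⟨j, hj⟩ := hex
      have hji : j ≠ i := by
        rintro rfl
        simp [Lam_self_eq_empty hp0] at hj
      right
      refine ⟨j, hji, ?_, ?_, fun j' => ?_⟩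
      · rw [h_eq hp hp0 hF (sub_nonneg.2 htr.le) hji hj, add_sub_cancel] at hj1
        exact e_injective hj1
      · rw [hj2, g_eq hji hj, sub_self]
      · rw [hM j']
        refine not_congr ⟨fun h => Lam_inj hp hp0 hF (sub_nonneg.2 htr.le) h hj, ?_⟩
        rintro rfl
        exact hj
    · left
      have hno : ∀ j, z ∉ Lam p F f c i j (r - t) := fun j hj => hex ⟨j, hj⟩
      rw [h_eq_zero fun j _ => hno j, add_zero] at hj1
      rw [g_eq_zero fun j _ => hno j, sub_zero] at hj2
      refine ⟨e_injective hj1, hj2, ?_⟩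
      have : shift t (⋃ j, region p F f c i j) ∩ {r} ×ˢ univ =
          ⋃ j, shift t (region p F f c i j) ∩ {r} ×ˢ univ := by
        ext w
        simp [shift]
      rw [this, measure_iUnion_null_iff]
      exact fun j => (hM j).2 (hno j)

/-- In the quiet period after `r` the left limits are still `i` and the age, so any point in a
translated region would be effective, and those have mass zero. -/
lemma extend {r : ℝ} (htr : t ≤ r) (hP : ∀ u ∈ Icc t r, x u = i ∧ y u = u - t) :
    ∃ r', r < r' ∧ (∀ u ∈ Icc t r', x u = i ∧ y u = u - t) ∧
      M (shift t (⋃ j, region p F f c i j) ∩ Ioc r r' ×ˢ univ) = 0 := by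
  obtain ⟨r', hr', hnull, hc⟩ := S.exists_quiet (ht.trans htr)
  have hP' : ∀ u ∈ Icc t r', x u = i ∧ y u = u - t := by
    intro u hu
    rcases le_total u r with h | h
    · exact hP u ⟨hu.1, h⟩
    · obtain ⟨h1, h2⟩ := hc u ⟨h, hu.2⟩
      obtain ⟨h3, h4⟩ := hP r ⟨htr, le_rfl⟩
      exact ⟨h1.trans h3, by rw [h2, h4]; ring⟩
  refine ⟨r', hr', hP', measure_mono_null ?_ hnull⟩
  intro q hq
  refine ⟨hq.2.1, ?_⟩
  have htq : t < q.1 := htr.trans_lt hq.2.1.1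
  obtain ⟨hl1, hl2⟩ := leftLim_of_growth htq fun u hu => hP' u ⟨hu.1, hu.2.le.trans hq.2.1.2⟩
  obtain ⟨j, hj⟩ := mem_iUnion.1 (show (q.1 - t, q.2) ∈ ⋃ j, region p F f c i j from hq.1)
  have hji : j ≠ i := by
    rintro rfl
    simpa [Lam_self_eq_empty hp0] using hj.2
  rw [hl1, hl2, h_eq hp hp0 hF (sub_nonneg.2 htq.le) hji hj.2, sub_ne_zero]
  exact fun he => hji (e_injective he)

/-- Continuous induction on `[t, r]`: the set of good end points is closed by `jump_or_not`, whose
jump alternative needs a point in the void window, and it extends to the right by `extend`. -/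
lemma growth {r : ℝ} (htr : t ≤ r) (hx : x t = i) (hy : y t = 0)
    (h0 : M (window (⋃ j, region p F f c i j) t r) = 0) :
    ∀ u ∈ Icc t r, x u = i ∧ y u = u - t := by
  let G : Set ℝ := {s | ∀ u ∈ Icc t s, x u = i ∧ y u = u - t}
  have htG : t ∈ G := by
    intro u hu
    have : u = t := le_antisymm hu.2 hu.1
    rw [this, sub_self]
    exact ⟨hx, hy⟩
  have hclosed : IsClosed (G ∩ Icc t r) := by
    refine isClosed_of_closure_subset fun s hs => ?_
    have hs' : s ∈ Icc t r := isClosed_Icc.closure_subset_iff.2 inter_subset_right hs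
    refine ⟨?_, hs'⟩
    have hlt : ∀ u ∈ Ico t s, x u = i ∧ y u = u - t := by
      intro u hu
      obtain ⟨v, hv, hvG⟩ := mem_closure_iff_nhds.1 hs (Ioi u) (Ioi_mem_nhds hu.2)
      exact hvG.1 u ⟨hu.1, le_of_lt hv⟩
    rcases hs'.1.eq_or_lt with rfl | hts
    · exact htG
    have hs1 : x s = i ∧ y s = s - t := by
      rcases jump_or_not S hp hp0 hF ht hts hlt with h | ⟨j, -, -, -, hj⟩
      · exact ⟨h.1, h.2.1⟩
      · exfalso
        refine (hj j).1 (measure_mono_null ?_ h0) rfl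
        intro w hw
        refine ⟨mem_iUnion.2 ⟨j, hw.1⟩, ?_, mem_univ _⟩
        have : w.1 = s := hw.2.1
        rw [this]
        exact ⟨hts, hs'.2⟩
    intro u hu
    rcases hu.2.eq_or_lt with rfl | h
    · exact hs1
    · exact hlt u ⟨hu.1, h⟩
  have := hclosed.Icc_subset_of_forall_exists_gt htG fun s hs v hv => by
    obtain ⟨r', hr', hP', -⟩ := extend S hp hp0 hF ht hs.2.1 hs.1
    refine ⟨min r' v, fun u hu => hP' u ⟨hu.1, hu.2.trans (min_le_left _ _)⟩, ?_, min_le_right _ _⟩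
    exact lt_min hr' hv
  exact this ⟨htr, le_rfl⟩

/-- One transition of the solution agrees with one step of `traj`. If there were no jump at
`nextTime`, `extend` would give a void window reaching beyond it, against its being an infimum. -/
lemma step (hx : x t = i) (hy : y t = 0) :
    (t : EReal) < nextTime (region p F f c) (i, (t : EReal)) M ∧
    (∀ r, t ≤ r → (r : EReal) < nextTime (region p F f c) (i, (t : EReal)) M →
      x r = i ∧ y r = r - t) ∧
    ∀ t' : ℝ, nextTime (region p F f c) (i, (t : EReal)) M = t' →
      nextState (region p F f c) (i, (t : EReal)) M ≠ i ∧
      x t' = nextState (region p F f c) (i, (t : EReal)) M ∧ y t' = 0 ∧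
      M (window (region p F f c i (nextState (region p F f c) (i, (t : EReal)) M)) t t') ≠ 0 := by
  set T := nextTime (region p F f c) (i, (t : EReal)) M with hTdef
  set U := ⋃ j, region p F f c i j with hU
  have hlt : ∀ e : EReal, T < e ↔ ∃ q : ℚ, (t : EReal) < ((q : ℝ) : EReal) ∧
      ((q : ℝ) : EReal) < e ∧ M (window U t q) ≠ 0 := by
    intro e
    rw [hTdef, nextTime_lt_iff]
    simp only [EReal.toReal_coe, avoids_iff S.locFinite]
    rfl
  have hle : ∀ r : ℝ, M (window U t r) = 0 → (r : EReal) ≤ T := by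
    intro r hr
    refine not_lt.1 fun h => ?_
    obtain ⟨q, -, hq, hq'⟩ := (hlt r).1 h
    exact hq' (measure_mono_null (window_mono_right U t (EReal.coe_lt_coe_iff.1 hq).le) hr)
  have hwin : ∀ r : ℝ, (r : EReal) < T → M (window U t r) = 0 := fun r hr =>
    measure_window_eq_zero S.locFinite hr
  have htT : (t : EReal) < T := by
    obtain ⟨r', hr', -, hnull⟩ := extend S hp hp0 hF ht le_rfl (i := i) fun u hu => by
      have : u = t := le_antisymm hu.2 hu.1
      rw [this, sub_self]
      exact ⟨hx, hy⟩
    exact (EReal.coe_lt_coe_iff.2 hr').trans_le (hle r' hnull)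
  have hgrow : ∀ r, t ≤ r → (r : EReal) < T → x r = i ∧ y r = r - t := fun r hr hrT =>
    growth S hp hp0 hF ht hr hx hy (hwin r hrT) r ⟨hr, le_rfl⟩
  refine ⟨htT, hgrow, fun t' ht' => ?_⟩
  have htt' : t < t' := by
    rw [ht'] at htT
    exact_mod_cast htT
  have hP : ∀ u ∈ Ico t t', x u = i ∧ y u = u - t := by
    intro u hu
    refine hgrow u hu.1 ?_
    rw [ht']
    exact_mod_cast hu.2
  -- The open interval is covered by countably many windows with rational end points before `t'`,
  -- each of them null.
  have hopen : M (shift t U ∩ Ioo t t' ×ˢ univ) = 0 := by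
    refine measure_mono_null (t := ⋃ q : {q : ℚ // (q : ℝ) < t'}, window U t q.1) ?_
      (measure_iUnion_null fun q => hwin _ (by rw [ht']; exact_mod_cast q.2))
    intro w hw
    obtain ⟨q, hq1, hq2⟩ := exists_rat_btwn hw.2.1.2
    exact mem_iUnion.2 ⟨⟨q, hq2⟩, hw.1, ⟨hw.2.1.1, hq1.le⟩, mem_univ _⟩
  have hsplit : ∀ Q : Set (ℝ × ℝ), window Q t t' =
      (shift t Q ∩ Ioo t t' ×ˢ univ) ∪ (shift t Q ∩ {t'} ×ˢ univ) := by
    intro Q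
    rw [← inter_union_distrib_left, ← union_prod, Ioo_union_right htt', window]
  rcases jump_or_not S hp hp0 hF ht htt' hP with ⟨h1, h2, h3⟩ | ⟨j, hji, hxj, hyj, hj⟩
  · exfalso
    obtain ⟨r', hr', -, hnull⟩ := extend S hp hp0 hF ht htt'.le (i := i) fun u hu => by
      rcases hu.2.eq_or_lt with rfl | h
      · exact ⟨h1, h2⟩
      · exact hP u ⟨hu.1, h⟩
    have h4 : M (window U t r') = 0 := by
      have : window U t r' = window U t t' ∪ (shift t U ∩ Ioc t' r' ×ˢ univ) := by
        rw [window, window, ← inter_union_distrib_left, ← union_prod,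
          Ioc_union_Ioc_eq_Ioc htt'.le hr'.le]
      rw [this, hsplit, measure_union_null_iff, measure_union_null_iff]
      exact ⟨⟨hopen, h3⟩, hnull⟩
    have := hle r' h4
    rw [ht'] at this
    exact absurd (EReal.coe_le_coe_iff.1 this) (not_le.2 hr')
  · have hwj : ∀ j', M (window (region p F f c i j') t t') = 0 ↔ j' ≠ j := by
      intro j'
      rw [hsplit, measure_union_null_iff, ← hj j', and_iff_right]
      refine measure_mono_null (inter_subset_inter_left _ ?_) hopen
      intro w hw
      exact mem_iUnion.2 ⟨j', hw⟩
    -- Only `j` has a charged window up to `t'`, so the arbitrary choice in `select` has a single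
    -- candidate.
    have hns : nextState (region p F f c) (i, (t : EReal)) M = j := by
      have h5 : nextState (region p F f c) (i, (t : EReal)) M = select i fun j' => j' = j := by
        rw [nextState, ← hTdef, ht']
        simp only [EReal.toReal_coe, avoids_iff S.locFinite, hwj, not_not]
      have hex : ∃ j', j' = j := ⟨j, rfl⟩
      rw [h5, select, dif_pos hex]
      exact hex.choose_spec
    rw [hns]
    exact ⟨hji, hxj, hyj, fun h => (hwj j).1 h rfl⟩

end Step

section Trajectory

variable (S : PathSolution p F f c M x y) (hp : p ∈ Matrix.rowStochastic ℝ (Fin k))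
  (hp0 : ∀ i, p i i = 0) (hF : ∀ i, IsHoldingTimeDistribution (F i) (f i))

lemma traj_eq_mk {R : Fin k → Fin k → Set (ℝ × ℝ)} {i : Fin k} {n : ℕ}
    (hT : (traj R i M n).2 ≠ ⊤) :
    traj R i M n = ((traj R i M n).1, ((traj R i M n).2.toReal : EReal)) :=
  Prod.ext rfl (EReal.coe_toReal hT
    (ne_bot_of_le_ne_bot EReal.zero_ne_bot (traj_time_nonneg i M n))).symm

include S hp hp0 hF

lemma state_traj (n : ℕ) (hT : (traj (region p F f c) (x 0) M n).2 ≠ ⊤) :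
    x (traj (region p F f c) (x 0) M n).2.toReal = (traj (region p F f c) (x 0) M n).1 ∧
    y (traj (region p F f c) (x 0) M n).2.toReal = 0 := by
  induction n with
  | zero =>
    refine ⟨by simp [traj], ?_⟩
    have := S.eq_y 0 le_rfl
    simpa [traj] using this
  | succ n ih =>
    have hT' : (traj (region p F f c) (x 0) M n).2 ≠ ⊤ :=
      ne_top_of_le_ne_top hT (traj_time_mono _ _ n.le_succ)
    obtain ⟨h1, h2⟩ := ih hT'
    have h3 := (step S hp hp0 hF (EReal.toReal_nonneg (traj_time_nonneg _ _ n)) h1 h2).2.2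
    rw [← traj_eq_mk hT'] at h3
    have h4 := h3 _ (Prod.ext_iff.1 (traj_eq_mk hT)).2
    exact ⟨h4.2.1, h4.2.2.1⟩

lemma traj_step (n : ℕ) (hT : (traj (region p F f c) (x 0) M n).2 ≠ ⊤) :
    (traj (region p F f c) (x 0) M n).2 < (traj (region p F f c) (x 0) M (n + 1)).2 ∧
    (∀ r : ℝ, (traj (region p F f c) (x 0) M n).2.toReal ≤ r →
      r < (traj (region p F f c) (x 0) M (n + 1)).2 →
      x r = (traj (region p F f c) (x 0) M n).1) ∧
    ((traj (region p F f c) (x 0) M (n + 1)).2 ≠ ⊤ →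
      (traj (region p F f c) (x 0) M (n + 1)).1 ≠ (traj (region p F f c) (x 0) M n).1 ∧
      M (window (region p F f c (traj (region p F f c) (x 0) M n).1
        (traj (region p F f c) (x 0) M (n + 1)).1) (traj (region p F f c) (x 0) M n).2.toReal
        (traj (region p F f c) (x 0) M (n + 1)).2.toReal) ≠ 0) := by
  obtain ⟨h1, h2⟩ := state_traj S hp hp0 hF n hT
  have h3 := step S hp hp0 hF (EReal.toReal_nonneg (traj_time_nonneg _ _ n)) h1 h2
  rw [← traj_eq_mk hT] at h3
  refine ⟨?_, fun r hr hr' => (h3.2.1 r hr hr').1, fun hT' => ?_⟩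
  · rw [(Prod.ext_iff.1 (traj_eq_mk hT)).2]
    exact h3.1
  · have h4 := h3.2.2 _ (Prod.ext_iff.1 (traj_eq_mk hT')).2
    exact ⟨h4.1, h4.2.2.2⟩

/-- The transition times of a path with left limits do not accumulate. -/
lemma tendsto_traj_time (hT : ∀ n, (traj (region p F f c) (x 0) M n).2 ≠ ⊤) :
    StrictMono (fun n => (traj (region p F f c) (x 0) M n).2.toReal) ∧
    Tendsto (fun n => (traj (region p F f c) (x 0) M n).2.toReal) atTop atTop := by
  have hmono : StrictMono (fun n => (traj (region p F f c) (x 0) M n).2.toReal) := by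
    refine strictMono_nat_of_lt_succ fun n => ?_
    have h1 := (traj_step S hp hp0 hF n (hT n)).1
    rw [(Prod.ext_iff.1 (traj_eq_mk (hT n))).2, (Prod.ext_iff.1 (traj_eq_mk (hT (n + 1)))).2] at h1
    exact EReal.coe_lt_coe_iff.1 h1
  refine ⟨hmono, (tendsto_atTop_of_monotone hmono.monotone).resolve_right ?_⟩
  rintro ⟨σ, hσ⟩
  have hlt : ∀ n, (traj (region p F f c) (x 0) M n).2.toReal < σ := fun n =>
    (hmono n.lt_succ_self).trans_le (hmono.monotone.ge_of_tendsto hσ _)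
  obtain ⟨⟨i, hi⟩, -⟩ := S.leftLimits σ
    ((EReal.toReal_nonneg (traj_time_nonneg _ _ 0)).trans_lt (hlt 0))
  -- The state space is discrete, so a left limit at `σ` forces the states at the transition times
  -- to be eventually constant, while consecutive ones differ.
  have h1 : ∀ᶠ n in atTop, x (traj (region p F f c) (x 0) M n).2.toReal = i :=
    (tendsto_nhdsWithin_iff.2 ⟨hσ, Eventually.of_forall hlt⟩).eventually
      (hi.eventually (p := fun a => a = i) (by rw [nhds_discrete]; exact eventually_pure.2 rfl))
  obtain ⟨n, hn⟩ := eventually_atTop.1 h1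
  refine ((traj_step S hp hp0 hF n (hT n)).2.2 (hT (n + 1))).1 ?_
  rw [← (state_traj S hp hp0 hF n (hT n)).1, ← (state_traj S hp hp0 hF (n + 1) (hT (n + 1))).1,
    hn n le_rfl, hn (n + 1) n.le_succ]

end Trajectory

end PathSolution

/-! ### Comparison of derivatives. -/

/-- If the increments of `q` satisfy the bound that holds for the occurrence of a transition of
relative frequency `a` before the first transition, then `q ≤ m a G`. -/
lemma le_of_increment_le {G g q : ℝ → ℝ} (hG : IsHoldingTimeDistribution G g) {m a : ℝ}
    (hm : 0 ≤ m) (ha : 0 ≤ a) (hq0 : q 0 ≤ 0) (hmono : ∀ s t, 0 ≤ s → s ≤ t → q s ≤ q t)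
    (hinc : ∀ s t, 0 ≤ s → s ≤ t → q t - q s ≤ m * (Real.exp (-cumHazard G s) *
      (1 - Real.exp (-(a * (cumHazard G t - cumHazard G s)))))) {y : ℝ} (hy : 0 ≤ y) :
    q y ≤ m * (a * G y) := by
  have hH0 : ∀ s, 0 ≤ s → 0 ≤ cumHazard G s := fun s hs =>
    hG.cumHazard_zero ▸ hG.cumHazard_monotone hs
  have hlin : ∀ s t, 0 ≤ s → s ≤ t → q t - q s ≤ m * (Real.exp (-cumHazard G s) *
      (a * (cumHazard G t - cumHazard G s))) := by
    intro s t hs hst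
    refine (hinc s t hs hst).trans (mul_le_mul_of_nonneg_left (mul_le_mul_of_nonneg_left ?_
      (Real.exp_pos _).le) hm)
    linarith [Real.one_sub_le_exp_neg (a * (cumHazard G t - cumHazard G s))]
  have hlip : ∀ s t, 0 ≤ s → s ≤ t → |q t - q s| ≤ m * (a * |cumHazard G t - cumHazard G s|) := by
    intro s t hs hst
    rw [abs_of_nonneg (sub_nonneg.2 (hmono s t hs hst)),
      abs_of_nonneg (sub_nonneg.2 (hG.cumHazard_monotone hst))]
    refine (hlin s t hs hst).trans (mul_le_mul_of_nonneg_left ?_ hm)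
    refine mul_le_of_le_one_left
      (mul_nonneg ha (sub_nonneg.2 (hG.cumHazard_monotone hst))) ?_
    exact Real.exp_le_one_iff.2 (neg_nonpos.2 (hH0 s hs))
  have hlip' : ∀ s t, 0 ≤ s → 0 ≤ t → |q t - q s| ≤ m * (a * |cumHazard G t - cumHazard G s|) := by
    intro s t hs ht
    rcases le_total s t with h | h
    · exact hlip s t hs h
    · rw [abs_sub_comm, abs_sub_comm (cumHazard G t)]
      exact hlip t s ht h
  have hcont : ContinuousOn q (Icc 0 y) := by
    intro s hs
    have h1 : Tendsto (fun t => m * (a * |cumHazard G t - cumHazard G s|)) (𝓝[Icc 0 y] s) (𝓝 0) := by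
      have h2 : Continuous fun t => m * (a * |cumHazard G t - cumHazard G s|) := by
        have := hG.cumHazard_continuous
        fun_prop
      have h3 := (h2.tendsto s).mono_left (nhdsWithin_le_nhds (s := Icc 0 y))
      simpa using h3
    refine tendsto_iff_dist_tendsto_zero.2 (squeeze_zero' (Eventually.of_forall fun t => dist_nonneg)
      ?_ h1)
    filter_upwards [self_mem_nhdsWithin] with t ht
    rw [Real.dist_eq]
    exact hlip' s t hs.1 ht.1
  -- The function `q` need not be differentiable. It is continuous, its increments being dominated
  -- by those of `cumHazard G`, and its upper right slope is at most `m * (a * g s)`, because `exp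
  -- (-cumHazard G s) = 1 - G s` cancels the denominator of the hazard rate.
  refine image_le_of_liminf_slope_right_le_deriv_boundary (f := q) (a := 0) (b := y) hcont
    (B := fun t => m * (a * G t)) (B' := fun t => m * (a * g t)) ?_ ?_ ?_ ?_ ⟨hy, le_rfl⟩
  · simpa [hG.eq_zero 0 le_rfl] using hq0
  · have := hG.continuous
    fun_prop
  · intro s hs
    exact (((hG.hasDeriv s hs.1).mono (Ici_subset_Ici.2 hs.1)).const_mul a).const_mul m
  · intro s hs r hr
    refine Eventually.frequently ?_
    have h1 := ((hG.hasDerivWithinAt_cumHazard hs.1).mono (Ici_subset_Ici.2 hs.1)).Ioi_of_Ici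
    rw [hasDerivWithinAt_iff_tendsto_slope' (by simp)] at h1
    have h2 := ((h1.const_mul a).const_mul (Real.exp (-cumHazard G s))).const_mul m
    have h3 : m * (Real.exp (-cumHazard G s) * (a * (g s / (1 - G s)))) = m * (a * g s) := by
      rw [hG.exp_neg_cumHazard]
      have := (sub_pos.2 (hG.lt_one s)).ne'
      field_simp
    rw [h3] at h2
    filter_upwards [h2.eventually (gt_mem_nhds hr), self_mem_nhdsWithin] with t ht hst
    refine lt_of_le_of_lt ?_ ht
    have hst' : 0 < t - s := sub_pos.2 hst
    rw [slope_def_field, slope_def_field, div_le_iff₀ hst']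
    refine (hlin s t hs.1 (le_of_lt hst)).trans (le_of_eq ?_)
    field_simp

/-! ### The random sequences of states and transition times. -/

lemma shift_inter_Ioc (Q : Set (ℝ × ℝ)) (t a b : ℝ) :
    shift t (Q ∩ Ioc a b ×ˢ univ) = shift t Q ∩ Ioc (t + a) (t + b) ×ˢ univ := by
  ext w
  simp [shift, lt_sub_iff_add_lt, add_comm]

lemma shift_inter_Ioc_zero (Q : Set (ℝ × ℝ)) (t b : ℝ) :
    shift t (Q ∩ Ioc 0 b ×ˢ univ) = window Q t (t + b) := by
  rw [shift_inter_Ioc, add_zero, window]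

section Sequences

variable {Ω : Type*} {k : ℕ} (p : Matrix (Fin k) (Fin k) ℝ) (F f : Fin k → ℝ → ℝ) (c : ℝ)
  (N : Ω → Measure (ℝ × ℝ)) (X : ℝ → Ω → Fin k)

/-- The `n`-th state. -/
noncomputable def stateSeq (n : ℕ) (ω : Ω) : Fin k := (traj (region p F f c) (X 0 ω) (N ω) n).1

/-- The `n`-th transition time, possibly infinite. -/
noncomputable def timeSeq (n : ℕ) (ω : Ω) : EReal := (traj (region p F f c) (X 0 ω) (N ω) n).2

/-- The first `n + 1` states and transition times. -/
noncomputable def histSeq (n : ℕ) (ω : Ω) : Fin (n + 1) → Fin k × ℝ :=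
  hist (region p F f c) n (X 0 ω) (N ω)

variable {p F f c N X}

lemma traj_eq_seq {n : ℕ} {ω : Ω} (hT : timeSeq p F f c N X n ω ≠ ⊤) :
    traj (region p F f c) (X 0 ω) (N ω) n =
      (stateSeq p F f c N X n ω, ((timeSeq p F f c N X n ω).toReal : EReal)) :=
  PathSolution.traj_eq_mk hT

lemma add_lt_timeSeq_succ {n : ℕ} {ω : Ω} (hM : LocFinite (N ω)) {a : ℝ}
    (hT : timeSeq p F f c N X n ω ≠ ⊤)
    (h : (((timeSeq p F f c N X n ω).toReal + a : ℝ) : EReal) < timeSeq p F f c N X (n + 1) ω) :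
    Avoids (N ω) (shift (timeSeq p F f c N X n ω).toReal
      ((⋃ j, region p F f c (stateSeq p F f c N X n ω) j) ∩ Ioc 0 a ×ˢ univ)) := by
  rw [avoids_iff hM, shift_inter_Ioc_zero]
  refine measure_window_eq_zero hM ?_
  rw [← traj_eq_seq hT]
  exact h

variable [MeasurableSpace Ω]

lemma measurable_stateSeq (hF : ∀ i, IsHoldingTimeDistribution (F i) (f i)) (hN : Measurable N)
    (hX : Measurable (X 0)) (n : ℕ) : Measurable (stateSeq p F f c N X n) :=
  (measurable_traj (measurableSet_region hF) n).fst.comp (hX.prodMk hN)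

lemma measurable_timeSeq (hF : ∀ i, IsHoldingTimeDistribution (F i) (f i)) (hN : Measurable N)
    (hX : Measurable (X 0)) (n : ℕ) : Measurable (timeSeq p F f c N X n) :=
  (measurable_traj (measurableSet_region hF) n).snd.comp (hX.prodMk hN)

lemma measurable_histSeq (hF : ∀ i, IsHoldingTimeDistribution (F i) (f i)) (hN : Measurable N)
    (hX : Measurable (X 0)) (n : ℕ) : Measurable (histSeq p F f c N X n) :=
  (measurable_hist (measurableSet_region hF) n).comp (hX.prodMk hN)

end Sequences

/-! ### Conditional law of the next transition. -/

section Main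

variable {Ω : Type*} [MeasurableSpace Ω] {μ : Measure Ω} [IsProbabilityMeasure μ]
  {k : ℕ} {p : Matrix (Fin k) (Fin k) ℝ} {F f : Fin k → ℝ → ℝ} {c : ℝ}
  {N : Ω → Measure (ℝ × ℝ)} {X : ℝ → Ω → Fin k} {Y : ℝ → Ω → ℝ}

lemma IsSolution.ae_pathSolution (hN : IsPoissonRandomMeasure μ N intensity)
    (hsol : IsSolution p F f c μ N X Y) :
    ∀ᵐ ω ∂μ, PathSolution p F f c (N ω) (fun t => X t ω) (fun t => Y t ω) := by
  filter_upwards [hN.ae_locFinite, hN.integerValued, hN.ae_slice, hsol.leftLimits, hsol.integrable,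
    hsol.eq_X, hsol.eq_Y] with ω h1 h2 h3 h4 h5 h6 h7
  exact ⟨h1, h2, h3, h4, fun t ht => (h5 t ht).1, fun t ht => (h5 t ht).2, h6, h7⟩

variable (hp : p ∈ Matrix.rowStochastic ℝ (Fin k))
  (hp0 : ∀ i, p i i = 0) (hF : ∀ i, IsHoldingTimeDistribution (F i) (f i))
  (hN : IsPoissonRandomMeasure μ N intensity) (hX : Measurable (X 0)) (hind : IndepFun (X 0) N μ)
  (hpath : ∀ᵐ ω ∂μ, PathSolution p F f c (N ω) (fun t => X t ω) (fun t => Y t ω))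

section Step

variable {n : ℕ} (hT : ∀ᵐ ω ∂μ, timeSeq p F f c N X n ω ≠ ⊤) {i : Fin k}
  {A : Set (Fin (n + 1) → Fin k × ℝ)} (hA : MeasurableSet A)
  (hAi : ∀ v ∈ A, (v (Fin.last n)).1 = i)

include hp hp0 hF hN hX hind hT hA hAi

/-- Survival beyond age `y` forces all regions leaving `i` to be void up to age `y`. Finiteness of
the next transition time is not assumed, so that it can be deduced from this bound. -/
lemma measure_survive_le {y : ℝ} (hy : 0 ≤ y) :
    μ {ω | histSeq p F f c N X n ω ∈ A ∧
      (((timeSeq p F f c N X n ω).toReal + y : ℝ) : EReal) < timeSeq p F f c N X (n + 1) ω} ≤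
    ENNReal.ofReal (1 - F i y) * μ {ω | histSeq p F f c N X n ω ∈ A} := by
  set Q := (⋃ j, region p F f c i j) ∩ Ioc 0 y ×ˢ univ with hQ
  have hvol : volume Q = ENNReal.ofReal (cumHazard (F i) y) := by
    rw [hQ, volume_iUnion_region hp hp0 hF i le_rfl hy, (hF i).cumHazard_zero, sub_zero]
  have hH : 0 ≤ cumHazard (F i) y := (hF i).cumHazard_zero ▸ (hF i).cumHazard_monotone hy
  have key := measure_hist_avoids hN hX hind (measurableSet_region hF) n hT hA
    (Q := Q) ((MeasurableSet.iUnion (measurableSet_region hF i)).inter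
      (measurableSet_Ioc.prod MeasurableSet.univ))
    (fun w hw => ⟨hw.2.1.1, mem_univ _⟩) (by rw [hvol]; exact ENNReal.ofReal_ne_top)
  rw [hvol, ENNReal.toReal_ofReal hH, (hF i).exp_neg_cumHazard] at key
  refine le_trans (measure_mono_ae ?_) key.le
  filter_upwards [hT, hN.ae_locFinite] with ω hω hloc
  intro h
  refine ⟨h.1, ?_⟩
  have h1 := add_lt_timeSeq_succ hloc hω h.2
  have h2 : stateSeq p F f c N X n ω = i := hAi _ h.1
  rwa [h2] at h1

include hpath

/-- Up to a null set the event lies in `D₁ \ D`: the set `Q₁` is void but `Q₁ ∪ Q₂` is not. Both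
void probabilities come from the strong Markov property, and their difference is the right-hand
side. -/
lemma measure_transition_le (j : Fin k) {a b : ℝ} (ha : 0 ≤ a) (hab : a ≤ b)
    (hT' : ∀ᵐ ω ∂μ, timeSeq p F f c N X (n + 1) ω ≠ ⊤) :
    μ.real {ω | histSeq p F f c N X n ω ∈ A ∧ stateSeq p F f c N X (n + 1) ω = j ∧
      (timeSeq p F f c N X (n + 1) ω).toReal - (timeSeq p F f c N X n ω).toReal ∈ Ioc a b} ≤
    μ.real {ω | histSeq p F f c N X n ω ∈ A} * (Real.exp (-cumHazard (F i) a) *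
      (1 - Real.exp (-(p i j * (cumHazard (F i) b - cumHazard (F i) a))))) := by
  set Q₁ := (⋃ j, region p F f c i j) ∩ Ioc 0 a ×ˢ univ with hQ₁
  set Q₂ := region p F f c i j ∩ Ioc a b ×ˢ univ with hQ₂
  have hm₁ : MeasurableSet Q₁ := (MeasurableSet.iUnion (measurableSet_region hF i)).inter
    (measurableSet_Ioc.prod MeasurableSet.univ)
  have hm₂ : MeasurableSet Q₂ := (measurableSet_region hF i j).inter
    (measurableSet_Ioc.prod MeasurableSet.univ)
  have hH : 0 ≤ cumHazard (F i) a := (hF i).cumHazard_zero ▸ (hF i).cumHazard_monotone ha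
  have hH' : 0 ≤ p i j * (cumHazard (F i) b - cumHazard (F i) a) :=
    mul_nonneg (hp.1 i j) (sub_nonneg.2 ((hF i).cumHazard_monotone hab))
  have hv₁ : volume Q₁ = ENNReal.ofReal (cumHazard (F i) a) := by
    rw [hQ₁, volume_iUnion_region hp hp0 hF i le_rfl ha, (hF i).cumHazard_zero, sub_zero]
  have hv₂ : volume Q₂ = ENNReal.ofReal (p i j * (cumHazard (F i) b - cumHazard (F i) a)) :=
    volume_region hp hF i j ha hab
  have hv : volume (Q₁ ∪ Q₂) = ENNReal.ofReal (cumHazard (F i) a +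
      p i j * (cumHazard (F i) b - cumHazard (F i) a)) := by
    rw [measure_union _ hm₂, hv₁, hv₂, ENNReal.ofReal_add hH hH']
    exact disjoint_left.2 fun w h1 h2 => absurd h1.2.1.2 (not_le.2 h2.2.1.1)
  have key₁ := measure_hist_avoids hN hX hind (measurableSet_region hF) n hT hA
    (Q := Q₁) hm₁ (fun w hw => ⟨hw.2.1.1, mem_univ _⟩) (by rw [hv₁]; exact ENNReal.ofReal_ne_top)
  have key := measure_hist_avoids hN hX hind (measurableSet_region hF) n hT hA
    (Q := Q₁ ∪ Q₂) (hm₁.union hm₂)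
    (union_subset (fun w hw => ⟨hw.2.1.1, mem_univ _⟩)
      (fun w hw => ⟨ha.trans_lt hw.2.1.1, mem_univ _⟩))
    (by rw [hv]; exact ENNReal.ofReal_ne_top)
  rw [hv₁, ENNReal.toReal_ofReal hH] at key₁
  rw [hv, ENNReal.toReal_ofReal (add_nonneg hH hH')] at key
  set D₁ := {ω | hist (region p F f c) n (X 0 ω) (N ω) ∈ A ∧ Avoids (N ω)
    (shift (traj (region p F f c) (X 0 ω) (N ω) n).2.toReal Q₁)}
  set D := {ω | hist (region p F f c) n (X 0 ω) (N ω) ∈ A ∧ Avoids (N ω)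
    (shift (traj (region p F f c) (X 0 ω) (N ω) n).2.toReal (Q₁ ∪ Q₂))}
  have hDm : MeasurableSet D := (hA.preimage (measurable_histSeq hF hN.measurable hX n)).inter
    (measurableSet_avoids_shift hN.measurable (measurable_timeSeq hF hN.measurable hX n).ereal_toReal
      (hm₁.union hm₂))
  have hDD : D ⊆ D₁ := fun ω hω => ⟨hω.1, hω.2.mono fun w hw => Or.inl hw⟩
  have hreal₁ : μ.real D₁ = Real.exp (-cumHazard (F i) a) *
      μ.real {ω | histSeq p F f c N X n ω ∈ A} := by
    rw [measureReal_def, key₁, ENNReal.toReal_mul, ENNReal.toReal_ofReal (Real.exp_pos _).le]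
    rfl
  have hreal : μ.real D = Real.exp (-(cumHazard (F i) a +
      p i j * (cumHazard (F i) b - cumHazard (F i) a))) *
      μ.real {ω | histSeq p F f c N X n ω ∈ A} := by
    rw [measureReal_def, key, ENNReal.toReal_mul, ENNReal.toReal_ofReal (Real.exp_pos _).le]
    rfl
  calc _ ≤ μ.real (D₁ \ D) := by
        refine ENNReal.toReal_mono (measure_ne_top _ _) (measure_mono_ae ?_)
        filter_upwards [hT, hT', hN.ae_locFinite, hpath] with ω hω hω' hloc hS
        rintro ⟨h1, h2, h3⟩
        have hi : stateSeq p F f c N X n ω = i := hAi _ h1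
        have h4 : (((timeSeq p F f c N X n ω).toReal + a : ℝ) : EReal) <
            timeSeq p F f c N X (n + 1) ω := by
          rw [← EReal.coe_toReal hω' (ne_bot_of_le_ne_bot EReal.zero_ne_bot
            (traj_time_nonneg _ _ _)), EReal.coe_lt_coe_iff]
          linarith [h3.1]
        have h5 := add_lt_timeSeq_succ hloc hω h4
        rw [hi] at h5
        refine ⟨⟨h1, h5⟩, fun h6 => ?_⟩
        -- The window of the region that causes the transition is charged, yet its points have age
        -- at most `a` and lie in `Q₁`, or age in `(a, b]` and lie in `Q₂`.
        refine ((hS.traj_step hp hp0 hF n hω).2.2 hω').2 ?_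
        have h7 := (avoids_iff hloc).1 h6.2
        refine measure_mono_null ?_ h7
        intro w hw
        change w ∈ window (region p F f c (stateSeq p F f c N X n ω)
          (stateSeq p F f c N X (n + 1) ω)) (timeSeq p F f c N X n ω).toReal
          (timeSeq p F f c N X (n + 1) ω).toReal at hw
        rw [hi, h2] at hw
        have h8 := hw.2.1
        change (w.1 - (timeSeq p F f c N X n ω).toReal, w.2) ∈ Q₁ ∪ Q₂
        rcases le_or_gt (w.1 - (timeSeq p F f c N X n ω).toReal) a with h | h
        · exact Or.inl ⟨mem_iUnion.2 ⟨j, hw.1⟩, ⟨sub_pos.2 h8.1, h⟩, mem_univ _⟩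
        · refine Or.inr ⟨hw.1, ⟨h, ?_⟩, mem_univ _⟩
          change w.1 - (timeSeq p F f c N X n ω).toReal ≤ b
          linarith [h3.2, h8.2]
    _ = μ.real D₁ - μ.real D := measureReal_sdiff hDD hDm
    _ = _ := by
        rw [hreal₁, hreal, neg_add, Real.exp_add]
        ring

/-- The conditional law of the next transition, on an event determined by the past. -/
lemma measureReal_transition (j : Fin k) (y : ℝ)
    (hT' : ∀ᵐ ω ∂μ, timeSeq p F f c N X (n + 1) ω ≠ ⊤) :
    μ.real {ω | histSeq p F f c N X n ω ∈ A ∧ stateSeq p F f c N X (n + 1) ω = j ∧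
      (timeSeq p F f c N X (n + 1) ω).toReal - (timeSeq p F f c N X n ω).toReal ≤ y} =
    μ.real {ω | histSeq p F f c N X n ω ∈ A} * (p i j * F i y) := by
  set m := μ.real {ω | histSeq p F f c N X n ω ∈ A} with hm
  have hm0 : 0 ≤ m := measureReal_nonneg
  let τ : Ω → ℝ := fun ω =>
    (timeSeq p F f c N X (n + 1) ω).toReal - (timeSeq p F f c N X n ω).toReal
  have hτm : Measurable τ := (measurable_timeSeq hF hN.measurable hX (n + 1)).ereal_toReal.sub
    (measurable_timeSeq hF hN.measurable hX n).ereal_toReal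
  have hAm : MeasurableSet {ω | histSeq p F f c N X n ω ∈ A} :=
    hA.preimage (measurable_histSeq hF hN.measurable hX n)
  have hJm : ∀ j, MeasurableSet {ω | stateSeq p F f c N X (n + 1) ω = j} := fun j =>
    (measurableSet_singleton j).preimage (measurable_stateSeq hF hN.measurable hX (n + 1))
  let E : Fin k → ℝ → Set Ω := fun j y =>
    {ω | histSeq p F f c N X n ω ∈ A ∧ stateSeq p F f c N X (n + 1) ω = j ∧ τ ω ≤ y}
  have hEm : ∀ j y, MeasurableSet (E j y) := fun j y =>
    hAm.inter ((hJm j).inter (measurableSet_le hτm measurable_const))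
  have hτpos : ∀ᵐ ω ∂μ, 0 < τ ω := by
    filter_upwards [hT, hT', hpath] with ω h1 h2 hS
    have h3 : timeSeq p F f c N X n ω < timeSeq p F f c N X (n + 1) ω :=
      (hS.traj_step hp hp0 hF n h1).1
    rw [← EReal.coe_toReal h1 (ne_bot_of_le_ne_bot EReal.zero_ne_bot (traj_time_nonneg _ _ _)),
      ← EReal.coe_toReal h2 (ne_bot_of_le_ne_bot EReal.zero_ne_bot (traj_time_nonneg _ _ _)),
      EReal.coe_lt_coe_iff] at h3
    exact sub_pos.2 h3
  have hEzero : ∀ j y, y ≤ 0 → μ.real (E j y) = 0 := by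
    intro j y hy
    rw [measureReal_def, measure_eq_zero_iff_ae_notMem.2, ENNReal.toReal_zero]
    filter_upwards [hτpos] with ω hω hE
    exact absurd (hE.2.2.trans hy) (not_le.2 hω)
  change μ.real (E j y) = m * (p i j * F i y)
  rcases le_or_gt y 0 with hy | hy
  · rw [hEzero j y hy, (hF i).eq_zero y hy]
    ring
  have hup : ∀ j, μ.real (E j y) ≤ m * (p i j * F i y) := by
    intro j
    refine le_of_increment_le (q := fun y => μ.real (E j y)) (hF i) hm0 (hp.1 i j)
      (hEzero j 0 le_rfl).le (fun s t _ hst => ?_) (fun s t hs hst => ?_) hy.le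
    · exact measureReal_mono fun ω hω => ⟨hω.1, hω.2.1, hω.2.2.trans hst⟩
    · have hsub : E j s ⊆ E j t := fun ω hω => ⟨hω.1, hω.2.1, hω.2.2.trans hst⟩
      rw [← measureReal_sdiff hsub (hEm j s)]
      refine le_trans (measureReal_mono ?_)
        (measure_transition_le hp hp0 hF hN hX hind hpath hT hA hAi j hs hst hT')
      rintro ω ⟨h1, h2⟩
      exact ⟨h1.1, h1.2.1, not_le.1 fun h => h2 ⟨h1.1, h1.2.1, h⟩, h1.2.2⟩
  have hsurv : μ.real {ω | histSeq p F f c N X n ω ∈ A ∧ y < τ ω} ≤ m * (1 - F i y) := by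
    have h1 := measure_survive_le hp hp0 hF hN hX hind hT hA hAi hy.le
    have h2 : μ {ω | histSeq p F f c N X n ω ∈ A ∧ y < τ ω} ≤
        ENNReal.ofReal (1 - F i y) * μ {ω | histSeq p F f c N X n ω ∈ A} := by
      refine le_trans (measure_mono_ae ?_) h1
      filter_upwards [hT'] with ω hω'
      intro h
      refine ⟨h.1, ?_⟩
      rw [← EReal.coe_toReal hω' (ne_bot_of_le_ne_bot EReal.zero_ne_bot
        (traj_time_nonneg _ _ _)), EReal.coe_lt_coe_iff]
      have h3 : y < (timeSeq p F f c N X (n + 1) ω).toReal -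
        (timeSeq p F f c N X n ω).toReal := h.2
      linarith
    have h3 := ENNReal.toReal_mono
      (ENNReal.mul_ne_top ENNReal.ofReal_ne_top (measure_ne_top _ _)) h2
    rw [ENNReal.toReal_mul, ENNReal.toReal_ofReal (sub_nonneg.2 ((hF i).le_one y)), mul_comm] at h3
    exact h3
  -- The upper bounds `m * (p i j * F i y)` and `m * (1 - F i y)` of the terms on the right also add
  -- up to `m`, so none of them can be strict.
  have htotal : m = ∑ j, μ.real (E j y) + μ.real {ω | histSeq p F f c N X n ω ∈ A ∧ y < τ ω} := by
    have h1 : {ω | histSeq p F f c N X n ω ∈ A} =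
        (⋃ j ∈ Finset.univ, E j y) ∪ {ω | histSeq p F f c N X n ω ∈ A ∧ y < τ ω} := by
      ext ω
      simp only [mem_ofPred_eq, mem_union, mem_iUnion, E, Finset.mem_univ, exists_const]
      constructor
      · intro h
        rcases le_or_gt (τ ω) y with h' | h'
        · exact Or.inl ⟨_, h, rfl, h'⟩
        · exact Or.inr ⟨h, h'⟩
      · rintro (⟨j, h⟩ | h)
        · exact h.1
        · exact h.1
    have h2 : MeasurableSet {ω | histSeq p F f c N X n ω ∈ A ∧ y < τ ω} :=
      hAm.inter (measurableSet_lt measurable_const hτm)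
    rw [hm, h1, measureReal_union _ h2 (measure_ne_top _ _) (measure_ne_top _ _),
      measureReal_biUnion_finset _ fun j _ => hEm j y]
    · intro a _ b _ hab
      exact disjoint_left.2 fun ω h1 h2 => hab (h1.2.1.symm.trans h2.2.1)
    · refine disjoint_left.2 fun ω h1 h2 => ?_
      simp only [mem_iUnion] at h1
      obtain ⟨j, -, h1⟩ := h1
      exact absurd h1.2.2 (not_le.2 h2.2)
  have hsum : ∑ j, m * (p i j * F i y) = m * F i y := by
    rw [← Finset.mul_sum, ← Finset.sum_mul, Matrix.sum_row_of_mem_rowStochastic hp, one_mul]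
  have hge : ∑ j, m * (p i j * F i y) ≤ ∑ j, μ.real (E j y) := by
    rw [hsum]
    linarith
  have heq := (Finset.sum_eq_sum_iff_of_le fun j _ => hup j).1
    (le_antisymm (Finset.sum_le_sum fun j _ => hup j) hge)
  exact heq j (Finset.mem_univ j)

end Step

include hp hp0 hF hN hX hind

/-- An infinite holding time outlasts every age `y`, and `1 - F i y` tends to `0`. The induction
supplies the finiteness of the `n`-th time that the strong Markov property requires. -/
lemma ae_timeSeq_ne_top (n : ℕ) : ∀ᵐ ω ∂μ, timeSeq p F f c N X n ω ≠ ⊤ := by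
  induction n with
  | zero => exact ae_of_all _ fun ω => EReal.zero_ne_top
  | succ n ih =>
    have key : ∀ i, μ {ω | stateSeq p F f c N X n ω = i ∧
        timeSeq p F f c N X (n + 1) ω = ⊤} = 0 := by
      intro i
      have hlim : Tendsto (fun y => ENNReal.ofReal (1 - F i y) *
          μ {ω | histSeq p F f c N X n ω ∈ {v | (v (Fin.last n)).1 = i}}) atTop (𝓝 0) := by
        have h1 := ENNReal.tendsto_ofReal ((hF i).tendsto_one.const_sub 1)
        rw [sub_self, ENNReal.ofReal_zero] at h1
        simpa using ENNReal.Tendsto.mul_const h1 (Or.inr (measure_ne_top _ _))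
      refine le_antisymm (ge_of_tendsto hlim ?_) zero_le
      filter_upwards [eventually_ge_atTop 0] with y hy
      refine le_trans (measure_mono ?_) (measure_survive_le hp hp0 hF hN hX hind ih
        (A := {v | (v (Fin.last n)).1 = i})
        ((measurableSet_singleton i).preimage (measurable_pi_apply (Fin.last n)).fst)
        (fun v hv => hv) hy)
      rintro ω ⟨h1, h2⟩
      refine ⟨h1, ?_⟩
      rw [h2]
      exact EReal.coe_lt_top _
    filter_upwards [ae_all_iff.2 fun i => measure_eq_zero_iff_ae_notMem.1 (key i)] with ω hω h
    exact hω _ ⟨rfl, h⟩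

include hpath

lemma condExp_transition (n : ℕ) (j : Fin k) (y : ℝ) :
    μ⟦{ω | stateSeq p F f c N X (n + 1) ω = j ∧
      (timeSeq p F f c N X (n + 1) ω).toReal - (timeSeq p F f c N X n ω).toReal ≤ y} |
      history (stateSeq p F f c N X) (fun n ω => (timeSeq p F f c N X n ω).toReal) n⟧
      =ᵐ[μ] fun ω => p (stateSeq p F f c N X n ω) j * F (stateSeq p F f c N X n ω) y := by
  have hHm := measurable_histSeq (p := p) (c := c) hF hN.measurable hX n
  have hle : history (stateSeq p F f c N X) (fun n ω => (timeSeq p F f c N X n ω).toReal) n ≤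
      (inferInstance : MeasurableSpace Ω) := hHm.comap_le
  set B := {ω | stateSeq p F f c N X (n + 1) ω = j ∧
      (timeSeq p F f c N X (n + 1) ω).toReal - (timeSeq p F f c N X n ω).toReal ≤ y} with hB
  have hBm : MeasurableSet B :=
    ((measurableSet_singleton j).preimage (measurable_stateSeq hF hN.measurable hX (n + 1))).inter
      (measurableSet_le ((measurable_timeSeq hF hN.measurable hX (n + 1)).ereal_toReal.sub
        (measurable_timeSeq hF hN.measurable hX n).ereal_toReal) measurable_const)
  let φ : Fin k → ℝ := fun i => p i j * F i y
  have hφ : Measurable fun ω => φ (stateSeq p F f c N X n ω) :=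
    (Measurable.of_discrete (f := φ)).comp (measurable_stateSeq hF hN.measurable hX n)
  have hφint : Integrable (fun ω => φ (stateSeq p F f c N X n ω)) μ := by
    refine Integrable.of_bound hφ.aestronglyMeasurable (∑ i, ‖φ i‖) (ae_of_all _ fun ω => ?_)
    exact Finset.single_le_sum (f := fun i => ‖φ i‖) (fun i _ => norm_nonneg _) (Finset.mem_univ _)
  refine (ae_eq_condExp_of_forall_setIntegral_eq hle ((integrable_const (1 : ℝ)).indicator hBm)
    (fun s _ _ => hφint.integrableOn) (fun s hs _ => ?_) ?_).symm
  · obtain ⟨A, hA, rfl⟩ := hs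
    -- Splitting by the current state makes the claimed conditional probability constant on each
    -- piece, where `measureReal_transition` applies.
    let A' : Fin k → Set (Fin (n + 1) → Fin k × ℝ) := fun i => A ∩ {v | (v (Fin.last n)).1 = i}
    have hA' : ∀ i, MeasurableSet (A' i) := fun i =>
      hA.inter ((measurableSet_singleton i).preimage (measurable_pi_apply (Fin.last n)).fst)
    have hU : histSeq p F f c N X n ⁻¹' A = ⋃ i, histSeq p F f c N X n ⁻¹' A' i := by
      ext ω
      simp [A']
    have hd : Pairwise (Function.onFun Disjoint fun i => histSeq p F f c N X n ⁻¹' A' i) := by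
      intro a b hab
      exact disjoint_left.2 fun ω h1 h2 => hab (h1.2.symm.trans h2.2)
    have hmeas : ∀ i, MeasurableSet (histSeq p F f c N X n ⁻¹' A' i) := fun i =>
      (hA' i).preimage hHm
    change ∫ ω in histSeq p F f c N X n ⁻¹' A, φ (stateSeq p F f c N X n ω) ∂μ =
      ∫ ω in histSeq p F f c N X n ⁻¹' A, B.indicator (fun _ => (1 : ℝ)) ω ∂μ
    rw [hU, integral_iUnion_fintype hmeas hd fun i => hφint.integrableOn,
      integral_iUnion_fintype hmeas hd fun i =>
        ((integrable_const (1 : ℝ)).indicator hBm).integrableOn]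
    refine Finset.sum_congr rfl fun i _ => ?_
    have h1 : ∫ ω in histSeq p F f c N X n ⁻¹' A' i, φ (stateSeq p F f c N X n ω) ∂μ =
        ∫ ω in histSeq p F f c N X n ⁻¹' A' i, φ i ∂μ := by
      refine setIntegral_congr_fun (hmeas i) fun ω hω => ?_
      have : stateSeq p F f c N X n ω = i := hω.2
      simp only [this]
    have h2 := measureReal_transition hp hp0 hF hN hX hind hpath
      (ae_timeSeq_ne_top hp hp0 hF hN hX hind n) (hA' i) (fun v hv => hv.2) j y
      (ae_timeSeq_ne_top hp hp0 hF hN hX hind (n + 1))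
    rw [h1, setIntegral_const, smul_eq_mul, integral_indicator_const _ hBm,
      measureReal_restrict_apply hBm, smul_eq_mul, mul_one, inter_comm]
    exact h2.symm
  · have h1 : Measurable[history (stateSeq p F f c N X)
        (fun n ω => (timeSeq p F f c N X n ω).toReal) n] (histSeq p F f c N X n) :=
      comap_measurable _
    have h2 : Measurable fun v : Fin (n + 1) → Fin k × ℝ => φ (v (Fin.last n)).1 :=
      (Measurable.of_discrete (f := φ)).comp (measurable_pi_apply (Fin.last n)).fst
    exact (h2.comp h1).stronglyMeasurable.aestronglyMeasurable

theorem isSemiMarkov_of_ae_pathSolution : IsSemiMarkov μ X p F := by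
  have hT := ae_all_iff.2 (ae_timeSeq_ne_top (c := c) hp hp0 hF hN hX hind)
  refine ⟨stateSeq p F f c N X, fun n ω => (timeSeq p F f c N X n ω).toReal,
    ⟨measurable_stateSeq hF hN.measurable hX, fun n => (measurable_timeSeq hF hN.measurable hX n).ereal_toReal,
      ae_of_all _ fun ω => ?_, ?_, condExp_transition hp hp0 hF hN hX hind hpath⟩, ?_⟩
  · simp [timeSeq, traj]
  · filter_upwards [hT, hpath] with ω hω hS
    exact (hS.tendsto_traj_time hp hp0 hF hω).1
  · filter_upwards [hT, hpath] with ω hω hS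
    refine ⟨(hS.tendsto_traj_time hp hp0 hF hω).2, fun n => ?_, fun n t h1 h2 => ?_⟩
    · exact ((hS.traj_step hp hp0 hF n (hω n)).2.2 (hω (n + 1))).1
    · refine (hS.traj_step hp hp0 hF n (hω n)).2.1 t h1 ?_
      change (t : EReal) < timeSeq p F f c N X (n + 1) ω
      rw [← EReal.coe_toReal (hω (n + 1)) (ne_bot_of_le_ne_bot EReal.zero_ne_bot
        (traj_time_nonneg _ _ _)), EReal.coe_lt_coe_iff]
      exact h2

end Main

end SemiMarkov

theorem theorem3p1 {Ω : Type*} [MeasurableSpace Ω] (μ : Measure Ω) [IsProbabilityMeasure μ]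
    {k : ℕ} (p : Matrix (Fin k) (Fin k) ℝ) (F f : Fin k → ℝ → ℝ)
    (hp : p ∈ Matrix.rowStochastic ℝ (Fin k)) (hp0 : ∀ i, p i i = 0) (hirr : p.IsIrreducible)
    (hF : ∀ i, SemiMarkov.IsHoldingTimeDistribution (F i) (f i))
    (c : ℝ) (N : Ω → Measure (ℝ × ℝ))
    (hN : SemiMarkov.IsPoissonRandomMeasure μ N SemiMarkov.intensity)
    (X : ℝ → Ω → Fin k) (Y : ℝ → Ω → ℝ)
    (hX : ∀ t, 0 ≤ t → Measurable (X t)) (hY : ∀ t, 0 ≤ t → Measurable (Y t))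
    (hindep : IndepFun (X 0) N μ)
    (hsol : SemiMarkov.IsSolution p F f c μ N X Y) :
    SemiMarkov.IsSemiMarkov μ X p F :=
  SemiMarkov.isSemiMarkov_of_ae_pathSolution hp hp0 hF hN (hX 0 le_rfl) hindep
    (hsol.ae_pathSolution hN)
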